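/- **Theorem 3.5 (strong law of large numbers for the two-level interacting tempering sampler).** Let $\mathsf X$ be a Polish space with its Borel $\sigma$-field $\mathcal X$, $\mu$ a measure on $(\mathsf X,\mathcal X)$, $T>1$, $\beta=1-1/T$ and $\upsilon\in(0,1)$. *Target.* Let $\pi$ be a probability density with respect to $\mu$ that is continuous, positive and bounded on $\mathsf X$, and put $\|\pi\|_\infty=\sup_{\mathsf X}\pi$. We also write $\pi$ for the probability measure $\pi\,d\mu$. Assume $\int\pi^{1/T}d\mu<\infty$ and let $\theta_\star$ be the probability measure with density proportional to $\pi^{1/T}$ with respect to $\mu$. *Kernels.* Let $P$ be a $\pi$-irreducible, aperiodic, (weak) Feller Markov transition kernel on $(\mathsf X,\mathcal X)$ with $\pi P=\pi$. Assume that there are $\tau\in(0,1/T)$, $\lambda\in(0,1)$ and $b<\infty$ with $PW\le\lambda W+b$, where $W(x)=(\pi(x)/\|\pi\|_\infty)^{-\tau}$, and that for every $p\in(0,\|\pi\|_\infty)$ the set $\{\pi\ge p\}$ is $1$-small for $P$: there are $\varepsilon>0$ and a probability measure $\nu$ with $P(x,\cdot)\ge\varepsilon\,\nu$ whenever $\pi(x)\ge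 p$. For a probability measure $\theta$ on $(\mathsf X,\mathcal X)$ set $$P_\theta(x,\cdot)=(1-\upsilon)P(x,\cdot)+\upsilon K_\theta(x,\cdot),\qquad K_\theta(x,A)=\int_A\alpha(x,y)\,\theta(dy)+\mathbf 1_A(x)\int\{1-\alpha(x,y)\}\,\theta(dy),$$ with $\alpha(x,y)=1\wedge\dfrac{\pi(y)^\beta}{\pi(x)^\beta}$. *Processes.* On a filtered probability space $(\Omega,\mathcal A,(\mathcal F_n)_{n\ge0},\mathbb P)$ let $(X_n)_{n\ge 0}$ and $(Y_n)_{n\ge 0}$ be $\mathsf X$-valued adapted processes such that, with $\theta_n=(n+1)^{-1}\sum_{k=0}^n\delta_{Y_k}$, for all $n\ge0$ and all bounded measurable $f:\mathsf X\to\mathbb R$, $$\mathbb E[f(X_{n+1})\mid\mathcal F_n]=P_{\theta_n}f(X_n)\quad\mathbb P\text{-a.s.}$$ For $V:\mathsf X\to[1,\infty)$ let $\mathcal L_V$ be the set of $f:\mathsf X\to\mathbb R$ with $\sup_x|f(x)|/V(x)<\infty$. Assume that $\theta_\star(W)<\infty$; that for every continuous $f\in\mathcal L_W$, $\theta_n(f)\to\theta_\star(f)$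 $\mathbb P$-a.s.; that $\sup_n\mathbb E[W(Y_n)]<\infty$; and that $\mathbb E[W(X_0)]<\infty$. Then: (i) for every measurable set $A$ with $\int_{\partial A}\pi\,d\mu=0$, where $\partial A$ is the boundary of $A$, $$\frac1n\sum_{k=0}^{n-1}\mathbf 1_A(X_k)\longrightarrow\int_A\pi\,d\mu\qquad\mathbb P\text{-a.s.};$$ (ii) for every $a\in(0,1)$ and every continuous $f\in\mathcal L_{W^a}$, the function $f\pi$ is $\mu$-integrable and $$\frac1n\sum_{k=0}^{n-1}f(X_k)\longrightarrow\int f\,\pi\,d\mu\qquad\mathbb P\text{-a.s.}$$ -/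

import Mathlib

open MeasureTheory ProbabilityTheory Filter Topology
open scoped ENNReal

namespace InteractingTempering

noncomputable section

variable {E : Type*}

section Kernels

variable [MeasurableSpace E]

/-- The kernel `P` is (weak) Feller: it maps bounded continuous functions to bounded continuous
functions (boundedness of `P f` is automatic for a Markov kernel). -/
def IsFeller [TopologicalSpace E] (P : Kernel E E) : Prop :=
  ∀ f : E → ℝ, Continuous f → (∃ C : ℝ, ∀ x, |f x| ≤ C) →
    Continuous fun x => ∫ y, f y ∂(P x)

/-- The kernel `P` is aperiodic with respect to the measure `ρ` (used for a `ρ`-irreducible kernel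
with invariant probability measure `ρ`): there are no `d ≥ 2` and no pairwise disjoint measurable
sets `D 0, …, D (d - 1)`, charged by `ρ`, through which the chain moves cyclically with
probability one. -/
def IsAperiodic (ρ : Measure E) (P : Kernel E E) : Prop :=
  ¬ ∃ d : ℕ, 2 ≤ d ∧ ∃ D : ℕ → Set E,
    (∀ i < d, MeasurableSet (D i)) ∧
    (∀ i < d, ∀ j < d, i ≠ j → Disjoint (D i) (D j)) ∧
    (∀ i < d, ∀ x ∈ D i, P x (D ((i + 1) % d)) = 1) ∧
    0 < ρ (D 0)

/-- The measurable set `C` is `1`-small for the kernel `P`: for some `ε > 0` and some probability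
measure `ν`, `P(x, ·) ≥ ε ν` for all `x ∈ C`. -/
def IsOneSmall (P : Kernel E E) (C : Set E) : Prop :=
  MeasurableSet C ∧ ∃ ε : ℝ, 0 < ε ∧ ∃ ν : Measure E, IsProbabilityMeasure ν ∧
    ∀ x ∈ C, ∀ A : Set E, MeasurableSet A → ENNReal.ofReal ε * ν A ≤ P x A

end Kernels

/-- The sup norm `‖π‖_∞` of a nonnegative bounded function `π`. -/
def supNorm (π : E → ℝ) : ℝ := ⨆ x, π x

/-- The drift function `W(x) = (π(x) / ‖π‖_∞) ^ (-τ)`. -/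
def driftW (π : E → ℝ) (τ : ℝ) (x : E) : ℝ := (π x / supNorm π) ^ (-τ)

/-- `f` belongs to `L_V`: its `V`-norm `sup_x |f x| / V x` is finite (here `V > 0`). -/
def MemL (V : E → ℝ) (f : E → ℝ) : Prop := ∃ C : ℝ, ∀ x, |f x| / V x ≤ C

/-- The acceptance ratio `α(x, y) = 1 ∧ π(y)^β / π(x)^β` with `β = 1 - 1/T`. -/
def accept (π : E → ℝ) (T : ℝ) (x y : E) : ℝ :=
  min 1 (π y ^ (1 - 1 / T) / π x ^ (1 - 1 / T))

variable [MeasurableSpace E]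

/-- The probability measure with density `π` with respect to `μ`. -/
def targetMeasure (μ : Measure E) (π : E → ℝ) : Measure E :=
  μ.withDensity fun x => ENNReal.ofReal (π x)

/-- The tempered measure `θ_⋆`, whose density with respect to `μ` is proportional to `π^{1/T}`
and normalised to total mass one (`π^{1/T}` has to be `μ`-integrable). -/
def temperedMeasure (μ : Measure E) (π : E → ℝ) (T : ℝ) : Measure E :=
  μ.withDensity fun x => ENNReal.ofReal (π x ^ (1 / T) / ∫ y, π y ^ (1 / T) ∂μ)

/-- The kernel
`K_θ(x, A) = ∫_A α(x, y) θ(dy) + 1_A(x) ∫ (1 - α(x, y)) θ(dy)`. -/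
def interactionKernel (π : E → ℝ) (T : ℝ) (θ : Measure E) (x : E) : Measure E :=
  θ.withDensity (fun y => ENNReal.ofReal (accept π T x y)) +
    (∫⁻ y, ENNReal.ofReal (1 - accept π T x y) ∂θ) • Measure.dirac x

/-- The kernel `P_θ(x, ·) = (1 - υ) P(x, ·) + υ K_θ(x, ·)`. -/
def samplerKernel (π : E → ℝ) (T υ : ℝ) (P : Kernel E E) (θ : Measure E) (x : E) : Measure E :=
  ENNReal.ofReal (1 - υ) • P x + ENNReal.ofReal υ • interactionKernel π T θ x

/-- The empirical measure `θ_n = (n + 1)⁻¹ ∑_{k=0}^n δ_{Y_k}`. -/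
def empiricalMeasure {Ω : Type*} (Y : ℕ → Ω → E) (n : ℕ) (ω : Ω) : Measure E :=
  ((n : ℝ≥0∞) + 1)⁻¹ • ∑ k ∈ Finset.range (n + 1), Measure.dirac (Y k ω)

/-- `(X, Y)` is a two-level interacting tempering process with respect to the filtration `ℱ`:
both processes are adapted, and given the past up to time `n` the state `X (n + 1)` is drawn from
`P_{θ_n}(X_n, ·)`, where `θ_n` is the empirical measure of `Y 0, …, Y n`. Nothing is required
of the law of `Y`. -/
structure IsSampler {Ω : Type*} [MeasurableSpace Ω] (Pr : Measure Ω)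
    (ℱ : Filtration ℕ (inferInstance : MeasurableSpace Ω))
    (π : E → ℝ) (T υ : ℝ) (P : Kernel E E) (X Y : ℕ → Ω → E) : Prop where
  adapted_X : ∀ n, Measurable[ℱ n] (X n)
  adapted_Y : ∀ n, Measurable[ℱ n] (Y n)
  condExp_eq : ∀ n : ℕ, ∀ f : E → ℝ, Measurable f → (∃ C : ℝ, ∀ x, |f x| ≤ C) →
    Pr[fun ω => f (X (n + 1) ω) | ℱ n] =ᵐ[Pr]
      fun ω => ∫ y, f y ∂(samplerKernel π T υ P (empiricalMeasure Y n ω) (X n ω))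

end

end InteractingTempering

open InteractingTempering

/-! Write `P⋆` for the sampler kernel at `θ⋆`, `W` for the drift function and `β = 1 - 1/T`. The
target is `θ⋆` reweighted by a multiple of `π^β`, and `π(x)^β α(x,y) = min (π(x)^β) (π(y)^β)` is
symmetric. Hence `K_{θ⋆}` is reversible for the target and `P⋆` leaves it invariant
(`integral_samplerOp_tempered`). The component `(1 - υ) P` gives `P⋆` a drift for every `W^a`
(Jensen) and a minorisation on the sublevel sets of `W`. Harris' theorem (`exists_contraction`) then
yields `|P⋆^N f - π(f)| ≤ B α^N W^a`, with `α < 1`, for continuous `f = O(W^a)`, a class stable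
under `P⋆` by the Feller property.

No Poisson equation is solved. It suffices that, for each continuous `h = O(W^a)` with `a < 1`, the
averages of `h(X_k) - P⋆h(X_k)` vanish almost surely. Applied to `h = P⋆^j f` for `j < N` and
telescoped, this replaces `f` by `P⋆^N f` in the averages. The remaining error is at most `B α^N`
times the averages of `W^a` along the path, which are almost surely bounded.

That difference has three parts: - The prediction error `h(X_{k+1}) - P_{θ_k}h(X_k)`. Only a first
moment of `W` is available, so `h` is truncated on `W ≤ k + 1`; L² martingale convergence and
Kronecker's lemma treat the truncated part, a weighted moment bound the rest
(`ae_tendsto_cesaroAvg_prediction`). - The adaptation error `P_{θ_k}h - P⋆h`. Since `α(x,y)` depends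
on `x` only through `r = π(x)^(-β)`, and does so in a Lipschitz way, convergence of `θ_k` on
countably many continuous functions is uniform over `W ≤ M`; elsewhere a slightly larger power of
`W` absorbs the error (`eventually_samplerOp_sub_le`). - A boundary term of order `h(X_n)/n`,
negligible because the averages of a larger power of `W` are bounded.

This gives (ii). Assertion (i) follows from the bounded continuous case by the portmanteau argument.
-/

namespace InteractingTempering

/-! ### Cesàro averages and Kronecker's lemma. -/

/-- The Cesàro averages of a real sequence. -/
noncomputable def cesaroAvg (u : ℕ → ℝ) (n : ℕ) : ℝ :=
  (1 / (n : ℝ)) * ∑ k ∈ Finset.range n, u k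

lemma cesaroAvg_add (u v : ℕ → ℝ) (n : ℕ) :
    cesaroAvg (fun k => u k + v k) n = cesaroAvg u n + cesaroAvg v n := by
  simp only [cesaroAvg, Finset.sum_add_distrib]; ring

lemma cesaroAvg_sub (u v : ℕ → ℝ) (n : ℕ) :
    cesaroAvg (fun k => u k - v k) n = cesaroAvg u n - cesaroAvg v n := by
  simp only [cesaroAvg, Finset.sum_sub_distrib]; ring

lemma cesaroAvg_const_mul (c : ℝ) (u : ℕ → ℝ) (n : ℕ) :
    cesaroAvg (fun k => c * u k) n = c * cesaroAvg u n := by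
  simp only [cesaroAvg, ← Finset.mul_sum]; ring

lemma cesaroAvg_const (c : ℝ) {n : ℕ} (hn : n ≠ 0) : cesaroAvg (fun _ => c) n = c := by
  have : (n : ℝ) ≠ 0 := by exact_mod_cast hn
  simp [cesaroAvg]; field_simp

lemma cesaroAvg_mono {u v : ℕ → ℝ} (h : ∀ k, u k ≤ v k) (n : ℕ) :
    cesaroAvg u n ≤ cesaroAvg v n :=
  mul_le_mul_of_nonneg_left (Finset.sum_le_sum fun k _ => h k) (by positivity)

lemma cesaroAvg_nonneg {u : ℕ → ℝ} (h : ∀ k, 0 ≤ u k) (n : ℕ) : 0 ≤ cesaroAvg u n :=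
  mul_nonneg (by positivity) (Finset.sum_nonneg fun k _ => h k)

lemma abs_cesaroAvg_le (u : ℕ → ℝ) (n : ℕ) : |cesaroAvg u n| ≤ cesaroAvg (fun k => |u k|) n := by
  unfold cesaroAvg
  rw [abs_mul, abs_of_nonneg (by positivity : (0 : ℝ) ≤ 1 / (n : ℝ))]
  exact mul_le_mul_of_nonneg_left (Finset.abs_sum_le_sum_abs _ _) (by positivity)

/-- One-step predictions compare time `k + 1` with time `k`; re-indexing costs only this boundary
term. -/
lemma cesaroAvg_shift (u : ℕ → ℝ) (n : ℕ) :
    cesaroAvg (fun k => u (k + 1)) n = cesaroAvg u n + (1 / (n : ℝ)) * (u n - u 0) := by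
  have h := Finset.sum_range_succ u n
  rw [Finset.sum_range_succ'] at h
  simp only [cesaroAvg]
  rw [eq_sub_of_add_eq h]; ring

/-- Kronecker's lemma for the weights `k + 1`. -/
lemma tendsto_cesaroAvg_of_tendsto_sum_div {x : ℕ → ℝ} {l : ℝ}
    (h : Tendsto (fun n => ∑ k ∈ Finset.range n, x k / ((k : ℝ) + 1)) atTop (𝓝 l)) :
    Tendsto (cesaroAvg x) atTop (𝓝 0) := by
  set s : ℕ → ℝ := fun n => ∑ k ∈ Finset.range n, x k / ((k : ℝ) + 1) with hs
  -- Summation by parts. After division by `n` the right side is `s n` minus its own Cesàro mean,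
  -- and both tend to `l`.
  have key : ∀ n, ∑ k ∈ Finset.range n, x k = n * s n - ∑ k ∈ Finset.range n, s k := by
    intro n
    induction n with
    | zero => simp
    | succ n ih =>
      rw [Finset.sum_range_succ, ih, Finset.sum_range_succ]
      have : s (n + 1) = s n + x n / ((n : ℝ) + 1) := by simp [hs, Finset.sum_range_succ]
      rw [this]
      have : (n : ℝ) + 1 ≠ 0 := by positivity
      push_cast; field_simp; ring
  have h2 := h.sub h.cesaro
  rw [sub_self] at h2
  refine h2.congr' ?_
  filter_upwards [eventually_ne_atTop 0] with n hn
  have : (n : ℝ) ≠ 0 := by exact_mod_cast hn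
  rw [cesaroAvg, key n]; field_simp

/-- Averages of a sequence that is eventually negligible with respect to a nonnegative sequence
with bounded averages tend to zero. -/
lemma tendsto_cesaroAvg_of_negligible {z w : ℕ → ℝ} {B : ℝ} (hw : ∀ k, 0 ≤ w k)
    (hB : ∀ n, cesaroAvg w n ≤ B) (hz : ∀ ε > 0, ∀ᶠ k in atTop, |z k| ≤ ε * w k) :
    Tendsto (cesaroAvg z) atTop (𝓝 0) := by
  have hB0 : 0 ≤ B := (cesaroAvg_nonneg hw 0).trans (hB 0)
  rw [Metric.tendsto_atTop]
  intro ε hε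
  -- The `+ 1` keeps the denominator positive when `B = 0`; the other `ε / 2` is for the finitely
  -- many early terms, collected in `K`.
  set η := ε / (2 * (B + 1)) with hη
  have hηpos : 0 < η := by positivity
  obtain ⟨N, hN⟩ := eventually_atTop.1 (hz η hηpos)
  set K := ∑ k ∈ Finset.range N, |z k| with hK
  have hbd : ∀ n, ∑ k ∈ Finset.range n, |z k| ≤ K + η * ∑ k ∈ Finset.range n, w k := by
    intro n
    rcases le_total n N with h | h
    · refine (Finset.sum_le_sum_of_subset_of_nonneg (Finset.range_mono h)
        fun _ _ _ => abs_nonneg _).trans ?_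
      exact le_add_of_nonneg_right (mul_nonneg hηpos.le (Finset.sum_nonneg fun k _ => hw k))
    · rw [← Finset.sum_range_add_sum_Ico _ h, ← Finset.sum_range_add_sum_Ico w h, mul_add]
      have h1 : ∑ k ∈ Finset.Ico N n, |z k| ≤ η * ∑ k ∈ Finset.Ico N n, w k := by
        rw [Finset.mul_sum]
        exact Finset.sum_le_sum fun k hk => hN k (Finset.mem_Ico.1 hk).1
      have h2 : 0 ≤ η * ∑ k ∈ Finset.range N, w k :=
        mul_nonneg hηpos.le (Finset.sum_nonneg fun k _ => hw k)
      linarith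
  obtain ⟨N', hN'⟩ := exists_nat_gt (2 * K / ε)
  refine ⟨N' + 1, fun n hn => ?_⟩
  have hn0 : (0 : ℝ) < n := by exact_mod_cast (by omega : 0 < n)
  have hn1 : 2 * K / ε < n := hN'.trans_le (by exact_mod_cast (by omega : N' ≤ n))
  rw [Real.dist_eq, sub_zero]
  refine (abs_cesaroAvg_le z n).trans_lt ?_
  have h1 : cesaroAvg (fun k => |z k|) n ≤ (1 / (n : ℝ)) * K + η * cesaroAvg w n := by
    have := mul_le_mul_of_nonneg_left (hbd n) (by positivity : (0 : ℝ) ≤ 1 / (n : ℝ))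
    simp only [cesaroAvg]
    linarith [this]
  have h2 : (1 / (n : ℝ)) * K < ε / 2 := by
    rw [div_lt_iff₀ hε] at hn1
    rw [one_div, inv_mul_lt_iff₀ hn0]; linarith
  have h3 : η * cesaroAvg w n ≤ ε / 2 := by
    refine (mul_le_mul_of_nonneg_left (hB n) hηpos.le).trans ?_
    rw [hη, div_mul_eq_mul_div, div_le_iff₀ (by positivity)]
    nlinarith
  linarith

/-! ### A strong law for martingale differences. -/

lemma integral_add_sq {Ω : Type*} [MeasurableSpace Ω] {m : Measure Ω} {f g : Ω → ℝ}
    (hf : MemLp f 2 m) (hg : MemLp g 2 m) :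
    ∫ ω, (f ω + g ω) ^ 2 ∂m
      = ∫ ω, f ω ^ 2 ∂m + 2 * ∫ ω, f ω * g ω ∂m + ∫ ω, g ω ^ 2 ∂m := by
  have hfg : Integrable (fun ω => f ω * g ω) m := hf.integrable_mul hg
  have h1 : Integrable (fun ω => f ω ^ 2 + 2 * (f ω * g ω)) m :=
    hf.integrable_sq.add (hfg.const_mul 2)
  rw [← integral_const_mul, ← integral_add hf.integrable_sq (hfg.const_mul 2),
    ← integral_add h1 hg.integrable_sq]
  exact integral_congr_ae (ae_of_all _ fun ω => by ring)

/-- A strong law of large numbers for differences of bounded random variables and their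
conditional expectations, under a summability condition on the second moments. -/
lemma ae_tendsto_cesaroAvg_sub_condExp {Ω : Type*} {m0 : MeasurableSpace Ω} {Pr : Measure Ω}
    [IsProbabilityMeasure Pr] (ℱ : Filtration ℕ m0) (ξ : ℕ → Ω → ℝ)
    (hmeas : ∀ k, Measurable[ℱ (k + 1)] (ξ k)) (hbdd : ∀ k, ∃ C, ∀ ω, |ξ k ω| ≤ C)
    (hsum : Summable fun k : ℕ => (∫ ω, ξ k ω ^ 2 ∂Pr) / ((k : ℝ) + 1) ^ 2) :
    ∀ᵐ ω ∂Pr, Tendsto (cesaroAvg fun k => ξ k ω - (Pr[ξ k | ℱ k]) ω) atTop (𝓝 0) := by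
  have hm0 : ∀ k, Measurable (ξ k) := fun k => (hmeas k).mono (ℱ.le _) le_rfl
  have hL2 : ∀ k, MemLp (ξ k) 2 Pr := fun k => by
    obtain ⟨C, hC⟩ := hbdd k
    exact MemLp.of_bound (hm0 k).aestronglyMeasurable C (ae_of_all _ fun ω => by simpa using hC ω)
  have hint : ∀ k, Integrable (ξ k) Pr := fun k => (hL2 k).integrable (by norm_num)
  have hcL2 : ∀ k, MemLp (Pr[ξ k | ℱ k]) 2 Pr := fun k => (hL2 k).condExp (by norm_num)
  -- The weights are those of Kronecker's lemma: almost sure convergence of the martingale `∑ d k`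
  -- is all that is needed.
  set d : ℕ → Ω → ℝ := fun k => ((k : ℝ) + 1)⁻¹ • (ξ k - Pr[ξ k | ℱ k]) with hd
  have hdL2 : ∀ k, MemLp (d k) 2 Pr := fun k => ((hL2 k).sub (hcL2 k)).const_smul _
  have hdm : ∀ k, StronglyMeasurable[ℱ (k + 1)] (d k) := fun k =>
    ((hmeas k).stronglyMeasurable.sub
      (stronglyMeasurable_condExp.mono (ℱ.mono (Nat.le_succ k)))).const_smul _
  set S : ℕ → Ω → ℝ := fun n => ∑ k ∈ Finset.range n, d k with hS
  have hSL2 : ∀ n, MemLp (S n) 2 Pr := fun n => memLp_finsetSum' _ fun k _ => hdL2 k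
  have hSm : ∀ n, StronglyMeasurable[ℱ n] (S n) := fun n =>
    Finset.stronglyMeasurable_sum _ fun k hk =>
      (hdm k).mono (ℱ.mono (by have := Finset.mem_range.1 hk; omega))
  have hSsucc : ∀ n, S (n + 1) = S n + d n := fun n => by simp [hS, Finset.sum_range_succ]
  have hdc : ∀ k, Pr[d k | ℱ k] =ᵐ[Pr] 0 := fun k => by
    refine (condExp_smul _ _ _).trans ?_
    filter_upwards [condExp_sub (hint k) (integrable_condExp (f := ξ k) (m := ℱ k)) (ℱ k)] with ω hω
    rw [Pi.smul_apply, hω, Pi.sub_apply]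
    rw [condExp_of_stronglyMeasurable (ℱ.le k) stronglyMeasurable_condExp integrable_condExp]
    simp
  have hmart : Martingale S ℱ Pr := by
    refine martingale_of_condExp_sub_eq_zero_nat hSm (fun n => (hSL2 n).integrable (by norm_num)) ?_
    intro n
    have : S (n + 1) - S n = d n := by rw [hSsucc]; abel
    rw [this]; exact hdc n
  have horth : ∀ n, ∫ ω, S n ω * d n ω ∂Pr = 0 := fun n => by
    have hi : Integrable (S n * d n) Pr := (hSL2 n).integrable_mul (hdL2 n)
    have h1 := condExp_mul_of_stronglyMeasurable_left (hSm n) hi ((hdL2 n).integrable (by norm_num))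
    have h2 : ∫ ω, (S n * d n) ω ∂Pr = 0 := by
      rw [← integral_condExp (ℱ.le n), integral_congr_ae h1]
      refine integral_eq_zero_of_ae ?_
      filter_upwards [hdc n] with ω hω
      simp [hω]
    exact h2
  -- The factor 4 comes from `(u - v)² ≤ 2u² + 2v²` and the L² contractivity `hc` of conditional
  -- expectation.
  have hdsq : ∀ k, ∫ ω, d k ω ^ 2 ∂Pr ≤ 4 * ((∫ ω, ξ k ω ^ 2 ∂Pr) / ((k : ℝ) + 1) ^ 2) := fun k => by
    have hc : ∫ ω, (Pr[ξ k | ℱ k]) ω ^ 2 ∂Pr ≤ ∫ ω, ξ k ω ^ 2 ∂Pr := by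
      have hi : Integrable (ξ k * Pr[ξ k | ℱ k]) Pr := (hL2 k).integrable_mul (hcL2 k)
      have h1 := condExp_mul_of_stronglyMeasurable_right
        (stronglyMeasurable_condExp (m := ℱ k) (μ := Pr) (f := ξ k)) hi (hint k)
      have h2 : ∫ ω, (ξ k * Pr[ξ k | ℱ k]) ω ∂Pr = ∫ ω, (Pr[ξ k | ℱ k]) ω ^ 2 ∂Pr := by
        rw [← integral_condExp (ℱ.le k), integral_congr_ae h1]
        exact integral_congr_ae (ae_of_all _ fun ω => by simp [sq])
      have h3 : 0 ≤ ∫ ω, (ξ k ω - (Pr[ξ k | ℱ k]) ω) ^ 2 ∂Pr :=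
        integral_nonneg fun ω => sq_nonneg _
      have h4 : ∫ ω, (ξ k ω - (Pr[ξ k | ℱ k]) ω) ^ 2 ∂Pr
          = ∫ ω, ξ k ω ^ 2 ∂Pr - 2 * ∫ ω, (ξ k * Pr[ξ k | ℱ k]) ω ∂Pr
            + ∫ ω, (Pr[ξ k | ℱ k]) ω ^ 2 ∂Pr := by
        have h := integral_add_sq (hL2 k) (hcL2 k).neg
        simp only [Pi.neg_apply, mul_neg, integral_neg, neg_sq, ← sub_eq_add_neg] at h
        exact h
      linarith
    have h5 : ∫ ω, d k ω ^ 2 ∂Pr ≤ ∫ ω, (((k : ℝ) + 1) ^ 2)⁻¹ *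
        (2 * ξ k ω ^ 2 + 2 * (Pr[ξ k | ℱ k]) ω ^ 2) ∂Pr := by
      refine integral_mono (hdL2 k).integrable_sq
        ((((hL2 k).integrable_sq.const_mul 2).add ((hcL2 k).integrable_sq.const_mul 2)).const_mul _)
        fun ω => ?_
      simp only [hd, Pi.smul_apply, Pi.sub_apply, smul_eq_mul, mul_pow, inv_pow]
      refine mul_le_mul_of_nonneg_left ?_ (by positivity)
      nlinarith [sq_nonneg (ξ k ω + (Pr[ξ k | ℱ k]) ω)]
    rw [integral_const_mul, integral_add ((hL2 k).integrable_sq.const_mul 2)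
      ((hcL2 k).integrable_sq.const_mul 2), integral_const_mul, integral_const_mul] at h5
    refine h5.trans ?_
    rw [div_eq_inv_mul, mul_left_comm]
    exact mul_le_mul_of_nonneg_left (by linarith) (by positivity)
  have hSsq : ∀ n, ∫ ω, S n ω ^ 2 ∂Pr
      ≤ ∑ k ∈ Finset.range n, 4 * ((∫ ω, ξ k ω ^ 2 ∂Pr) / ((k : ℝ) + 1) ^ 2) := fun n => by
    induction n with
    | zero => simp [hS]
    | succ n ih =>
      rw [Finset.sum_range_succ]
      have := integral_add_sq (hSL2 n) (hdL2 n)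
      rw [horth n] at this
      simp only [hSsucc, Pi.add_apply]
      rw [this]
      linarith [hdsq n]
  set B : ℝ := ∑' k : ℕ, 4 * ((∫ ω, ξ k ω ^ 2 ∂Pr) / ((k : ℝ) + 1) ^ 2) with hB
  have hSB : ∀ n, ∫ ω, S n ω ^ 2 ∂Pr ≤ B := fun n =>
    (hSsq n).trans ((hsum.mul_left 4).sum_le_tsum _ fun k _ =>
      mul_nonneg (by norm_num) (div_nonneg (integral_nonneg fun ω => sq_nonneg _) (by positivity)))
  -- Doob's convergence theorem asks for an L¹ bound, which follows from the L² bound through `|s| ≤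
  -- 1 + s²`.
  have hL1 : ∀ n, eLpNorm (S n) 1 Pr ≤ ((1 + B).toNNReal : ℝ≥0∞) := fun n => by
    rw [eLpNorm_one_eq_lintegral_enorm,
      ← ofReal_integral_norm_eq_lintegral_enorm ((hSL2 n).integrable (by norm_num))]
    refine ENNReal.ofReal_le_ofReal ?_
    calc ∫ ω, ‖S n ω‖ ∂Pr ≤ ∫ ω, (1 + S n ω ^ 2) ∂Pr := by
          refine integral_mono ((hSL2 n).integrable (by norm_num)).norm
            ((integrable_const 1).add (hSL2 n).integrable_sq) fun ω => ?_
          simp only [Real.norm_eq_abs]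
          nlinarith [sq_nonneg (|S n ω| - 1), sq_abs (S n ω), abs_nonneg (S n ω)]
      _ ≤ 1 + B := by
          rw [integral_add (integrable_const 1) (hSL2 n).integrable_sq]
          simpa using hSB n
  filter_upwards [hmart.submartingale.exists_ae_tendsto_of_bdd hL1] with ω ⟨l, hl⟩
  refine tendsto_cesaroAvg_of_tendsto_sum_div (l := l) (hl.congr fun n => ?_)
  simp only [hS, hd, Finset.sum_apply, Pi.smul_apply, Pi.sub_apply, smul_eq_mul]
  exact Finset.sum_congr rfl fun k _ => by rw [div_eq_inv_mul]

/-! ### Harris' theorem: weighted contraction and geometric convergence. -/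

/-- The hypothesis says that all the intervals `[Φ x - D x, Φ x + D x]` meet pairwise, so the
supremum of the left endpoints lies in each of them. This turns a two-point oscillation estimate
into a bound around a constant. -/
lemma exists_center {E : Type*} [Nonempty E] {Φ D : E → ℝ} (h : ∀ x y, Φ x - Φ y ≤ D x + D y) :
    ∃ c, ∀ x, |Φ x - c| ≤ D x := by
  obtain ⟨y⟩ := ‹Nonempty E›
  have hb : BddAbove (Set.range fun x => Φ x - D x) :=
    ⟨Φ y + D y, by rintro _ ⟨x, rfl⟩; have := h x y; simp only; linarith⟩
  have : Nonempty E := ⟨y⟩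
  refine ⟨⨆ x, (Φ x - D x), fun x => abs_le.2 ⟨?_, ?_⟩⟩
  · have : ⨆ z, (Φ z - D z) ≤ Φ x + D x := ciSup_le fun z => by have := h z x; linarith
    linarith
  · have := le_ciSup hb x
    linarith

/-- Under domination `ε ν ≤ m`, integrating a function bounded by `d` against `m - ε ν`. -/
lemma integral_sub_le_of_smul_le {E : Type*} [MeasurableSpace E] {m ν : Measure E} {ε : ℝ}
    (hε : 0 < ε) (hle : ∀ A, MeasurableSet A → ENNReal.ofReal ε * ν A ≤ m A) {ψ d : E → ℝ}
    (hψ : Integrable ψ m) (hd : Integrable d m) (h : ∀ x, |ψ x| ≤ d x) :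
    |∫ x, ψ x ∂m - ε * ∫ x, ψ x ∂ν| ≤ ∫ x, d x ∂m - ε * ∫ x, d x ∂ν := by
  have hle' : ENNReal.ofReal ε • ν ≤ m :=
    Measure.le_iff.2 fun A hA => by simpa using hle A hA
  have hεne : ENNReal.ofReal ε ≠ 0 := by simpa using hε
  have hψν : Integrable ψ ν := by
    have := hψ.mono_measure hle'
    rwa [integrable_smul_measure hεne ENNReal.ofReal_ne_top] at this
  have hdν : Integrable d ν := by
    have := hd.mono_measure hle'
    rwa [integrable_smul_measure hεne ENNReal.ofReal_ne_top] at this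
  have key : ∀ g : E → ℝ, (∀ x, 0 ≤ g x) → Integrable g m → ε * ∫ x, g x ∂ν ≤ ∫ x, g x ∂m := by
    intro g hg hgi
    have := integral_mono_measure hle' (ae_of_all _ hg) hgi
    rwa [integral_smul_measure, ENNReal.toReal_ofReal hε.le, smul_eq_mul] at this
  have h1 := key (fun x => d x - ψ x) (fun x => by have := abs_le.1 (h x); linarith) (hd.sub hψ)
  have h2 := key (fun x => d x + ψ x) (fun x => by have := abs_le.1 (h x); linarith) (hd.add hψ)
  rw [integral_sub hdν hψν, integral_sub hd hψ] at h1
  rw [integral_add hdν hψν, integral_add hd hψ] at h2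
  rw [abs_le]
  constructor <;> nlinarith

/-- Harris' theorem in the form of a weighted contraction: a drift condition towards the
sublevel sets of `V`, all of which are small, makes the transition operator contract weighted
oscillations. -/
lemma exists_contraction {E : Type*} [MeasurableSpace E] [Nonempty E] (m : E → Measure E)
    [∀ x, IsProbabilityMeasure (m x)] {V : E → ℝ} (hV0 : ∀ x, 0 ≤ V x)
    (hVi : ∀ x, Integrable V (m x)) {γ K : ℝ} (hγ0 : 0 ≤ γ) (hγ : γ < 1) (hK : 0 ≤ K)
    (hdrift : ∀ x, ∫ y, V y ∂(m x) ≤ γ * V x + K)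
    (hsmall : ∀ R, ∃ ε : ℝ, 0 < ε ∧ ∃ ν : Measure E, IsProbabilityMeasure ν ∧
      ∀ x, V x ≤ R → ∀ A, MeasurableSet A → ENNReal.ofReal ε * ν A ≤ m x A) :
    ∃ α κ : ℝ, 0 ≤ α ∧ α < 1 ∧ 0 < κ ∧ ∀ φ : E → ℝ, Measurable φ → ∀ k : ℝ, 0 ≤ k → ∀ c : ℝ,
      (∀ x, |φ x - c| ≤ k * (1 + κ * V x)) →
        ∃ c', ∀ x, |∫ y, φ y ∂(m x) - c'| ≤ α * k * (1 + κ * V x) := by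
  -- When `V x + V y ≥ R`, the drift gain `(1 - γ)(V x + V y)` is at least twice the loss `2 * K`;
  -- the `+ 1` ensures `R ≥ 1`, so that the constant `2` in the weight can also be contracted.
  set R : ℝ := 4 * K / (1 - γ) + 1 with hR
  have h1γ : 0 < 1 - γ := by linarith
  have hR1 : 1 ≤ R := by have : 0 ≤ 4 * K / (1 - γ) := by positivity
                         linarith
  have hRK : 4 * K ≤ (1 - γ) * R := by
    rw [hR, mul_add, mul_div_cancel₀ _ h1γ.ne']; linarith
  obtain ⟨ε, hε, ν, hν, hmin⟩ := hsmall R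
  -- A small weight on `V`: on the small set the total drift loss `2 * κ * K` stays below `ε`, half
  -- of the minorisation gain `2 * ε`.
  set κ : ℝ := ε / (2 * (K + 1)) with hκ
  have hκpos : 0 < κ := by positivity
  have hκK : 2 * κ * K ≤ ε := by
    have : κ * (2 * (K + 1)) = ε := div_mul_cancel₀ _ (by positivity)
    nlinarith
  obtain ⟨η, hη0, hη1, hη2, hη3⟩ : ∃ η : ℝ, 0 < η ∧ η ≤ ε / 2 ∧ η ≤ (1 - γ) / 4 ∧
      η ≤ κ * (1 - γ) / 8 := by
    refine ⟨min (ε / 2) (min ((1 - γ) / 4) (κ * (1 - γ) / 8)), ?_, min_le_left _ _,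
      (min_le_right _ _).trans (min_le_left _ _), (min_le_right _ _).trans (min_le_right _ _)⟩
    refine lt_min (by positivity) (lt_min (by positivity) (by positivity))
  refine ⟨1 - η, κ, by linarith, by linarith, hκpos, fun φ hφ k hk c hc => ?_⟩
  have hdi : ∀ x, Integrable (fun y => 1 + κ * V y) (m x) := fun x =>
    (integrable_const 1).add ((hVi x).const_mul κ)
  have hdint : ∀ x, ∫ y, (1 + κ * V y) ∂(m x) ≤ 1 + κ * (γ * V x + K) := fun x => by
    rw [integral_add (integrable_const 1) ((hVi x).const_mul κ), integral_const_mul]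
    have := mul_le_mul_of_nonneg_left (hdrift x) hκpos.le
    simpa using this
  have hψi : ∀ x, Integrable (fun y => φ y - c) (m x) := fun x =>
    ((hdi x).const_mul k).mono' (hφ.sub_const c).aestronglyMeasurable
      (ae_of_all _ fun y => by simpa using hc y)
  have hφψ : ∀ x, ∫ y, φ y ∂(m x) = ∫ y, (φ y - c) ∂(m x) + c := fun x => by
    have h : Integrable φ (m x) :=
      ((hψi x).add (integrable_const c)).congr (ae_of_all _ fun y => by simp)
    rw [integral_sub h (integrable_const c)]
    simp
  have hd1 : ∀ ρ : Measure E, IsProbabilityMeasure ρ → Integrable V ρ →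
      1 ≤ ∫ y, (1 + κ * V y) ∂ρ := fun ρ _ hρ => by
    rw [integral_add (integrable_const 1) (hρ.const_mul κ), integral_const_mul]
    have : 0 ≤ κ * ∫ y, V y ∂ρ := mul_nonneg hκpos.le (integral_nonneg hV0)
    simpa using this
  refine exists_center (fun x y => ?_)
  rw [hφψ x, hφψ y]
  have hS0 : 0 ≤ V x + V y := add_nonneg (hV0 x) (hV0 y)
  -- The two regimes below differ only in `B`: far out the drift alone suffices; otherwise the
  -- common part `ε ν` cancels from the difference.
  have hsuff : ∀ B : ℝ, B ≤ (1 - η) * (2 + κ * (V x + V y)) →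
      ∫ z, (φ z - c) ∂(m x) - ∫ z, (φ z - c) ∂(m y) ≤ k * B →
      ∫ z, (φ z - c) ∂(m x) + c - (∫ z, (φ z - c) ∂(m y) + c)
        ≤ (1 - η) * k * (1 + κ * V x) + (1 - η) * k * (1 + κ * V y) := by
    intro B hB h
    have := mul_le_mul_of_nonneg_left hB hk
    linarith
  rcases le_total R (V x + V y) with hS | hS
  · refine hsuff (2 + κ * (γ * (V x + V y) + 2 * K)) ?_ ?_
    · have h1 : η * (κ * (V x + V y)) ≤ (1 - γ) / 4 * (κ * (V x + V y)) :=
        mul_le_mul_of_nonneg_right hη2 (by positivity)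
      have h2 : κ * (4 * K) ≤ κ * ((1 - γ) * (V x + V y)) :=
        mul_le_mul_of_nonneg_left (hRK.trans (by nlinarith)) hκpos.le
      have h3 : κ * (1 - γ) * 1 ≤ κ * (1 - γ) * (V x + V y) :=
        mul_le_mul_of_nonneg_left (hR1.trans hS) (by positivity)
      nlinarith
    · have hb : ∀ z, |∫ y, (φ y - c) ∂(m z)| ≤ k * (1 + κ * (γ * V z + K)) := fun z => by
        refine (abs_integral_le_integral_abs).trans ?_
        refine (integral_mono (hψi z).abs ((hdi z).const_mul k) hc).trans ?_
        rw [integral_const_mul]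
        exact mul_le_mul_of_nonneg_left (hdint z) hk
      have hx := (abs_le.1 (hb x)).2
      have hy := (abs_le.1 (hb y)).1
      linarith
  · refine hsuff (2 + κ * (γ * (V x + V y) + 2 * K) - 2 * ε) ?_ ?_
    · have h1 : η * (κ * (V x + V y)) ≤ (1 - γ) * (κ * (V x + V y)) :=
        mul_le_mul_of_nonneg_right (by linarith) (by positivity)
      nlinarith
    · have hVx : V x ≤ R := by linarith [hV0 y]
      -- As `V ≥ 0`, a small sum puts both points in the same small set. Removing `ε ν` lowers each
      -- bound by at least `k * ε`, the weight `1 + κ * V` having `ν`-integral at least 1.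
      have hVy : V y ≤ R := by linarith [hV0 x]
      have hVν : Integrable V ν := by
        have hle' : ENNReal.ofReal ε • ν ≤ m x :=
          Measure.le_iff.2 fun A hA => by simpa using hmin x hVx A hA
        have := (hVi x).mono_measure hle'
        rwa [integrable_smul_measure (by simpa using hε) ENNReal.ofReal_ne_top] at this
      have hb : ∀ z, V z ≤ R →
          |∫ y, (φ y - c) ∂(m z) - ε * ∫ y, (φ y - c) ∂ν|
            ≤ k * (1 + κ * (γ * V z + K) - ε) := fun z hz => by
        refine (integral_sub_le_of_smul_le hε (hmin z hz) (hψi z) ((hdi z).const_mul k) hc).trans ?_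
        rw [integral_const_mul, integral_const_mul]
        have h1 := mul_le_mul_of_nonneg_left (hdint z) hk
        have h2 := mul_le_mul_of_nonneg_left
          (mul_le_mul_of_nonneg_left (hd1 ν hν hVν) hk) hε.le
        linarith
      have hx := (abs_le.1 (hb x hVx)).2
      have hy := (abs_le.1 (hb y hVy)).1
      linarith

/-- Geometric ergodicity on a class of functions that is stable under the transition operator. -/
lemma exists_geometric_bound {E : Type*} [MeasurableSpace E] [Nonempty E] (m : E → Measure E)
    [∀ x, IsProbabilityMeasure (m x)] {V : E → ℝ} (hV1 : ∀ x, 1 ≤ V x)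
    (hVi : ∀ x, Integrable V (m x)) {γ K : ℝ} (hγ0 : 0 ≤ γ) (hγ : γ < 1) (hK : 0 ≤ K)
    (hdrift : ∀ x, ∫ y, V y ∂(m x) ≤ γ * V x + K)
    (hsmall : ∀ R, ∃ ε : ℝ, 0 < ε ∧ ∃ ν : Measure E, IsProbabilityMeasure ν ∧
      ∀ x, V x ≤ R → ∀ A, MeasurableSet A → ENNReal.ofReal ε * ν A ≤ m x A)
    {ρ : Measure E} [IsProbabilityMeasure ρ] (hVρ : Integrable V ρ)
    {f : E → ℝ} {C : ℝ} (hfC : ∀ x, |f x| ≤ C * V x) (Q : (E → ℝ) → E → ℝ)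
    (hQ : ∀ φ x, Q φ x = ∫ y, φ y ∂(m x)) (hmeas : ∀ n, Measurable (Q^[n] f))
    (hinv : ∀ n, ∫ x, (Q^[n] f) x ∂ρ = ∫ x, f x ∂ρ) :
    ∃ α B : ℝ, 0 ≤ α ∧ α < 1 ∧ 0 ≤ B ∧
      ∀ n x, |(Q^[n] f) x - ∫ x, f x ∂ρ| ≤ B * α ^ n * V x := by
  have hV0 : ∀ x, 0 ≤ V x := fun x => zero_le_one.trans (hV1 x)
  obtain ⟨α, κ, hα0, hα1, hκ, hcontr⟩ :=
    exists_contraction m hV0 hVi hγ0 hγ hK hdrift hsmall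
  have hC0 : 0 ≤ C := by
    obtain ⟨x⟩ := ‹Nonempty E›
    have := (abs_nonneg _).trans (hfC x)
    exact nonneg_of_mul_nonneg_left this (zero_lt_one.trans_le (hV1 x))
  set k := C / κ with hk
  have hk0 : 0 ≤ k := by positivity
  have hiter : ∀ n, ∃ c, ∀ x, |(Q^[n] f) x - c| ≤ α ^ n * k * (1 + κ * V x) := by
    intro n
    induction n with
    | zero =>
      refine ⟨0, fun x => ?_⟩
      have h1 : k * (κ * V x) = C * V x := by rw [hk]; field_simp
      have := hfC x
      simp only [Function.iterate_zero, id, sub_zero, pow_zero, one_mul]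
      linarith
    | succ n ih =>
      obtain ⟨c, hc⟩ := ih
      obtain ⟨c', hc'⟩ := hcontr _ (hmeas n) (α ^ n * k) (by positivity) c hc
      refine ⟨c', fun x => ?_⟩
      rw [Function.iterate_succ_apply', hQ, pow_succ', mul_assoc α]
      exact hc' x
  have hdρ : Integrable (fun x => 1 + κ * V x) ρ := (integrable_const 1).add (hVρ.const_mul κ)
  set D := ∫ x, (1 + κ * V x) ∂ρ with hD
  have hD0 : 0 ≤ D := integral_nonneg fun x => by have := hV0 x; positivity
  refine ⟨α, k * (1 + κ + D), hα0, hα1, by positivity, fun n x => ?_⟩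
  obtain ⟨c, hc⟩ := hiter n
  have hi : Integrable (fun x => (Q^[n] f) x - c) ρ :=
    (hdρ.const_mul (α ^ n * k)).mono' ((hmeas n).sub_const c).aestronglyMeasurable
      (ae_of_all _ fun y => by simpa using hc y)
  -- The centre `c` depends on `n` and is not explicit; integrating its bound against the invariant
  -- `ρ` identifies it with `∫ f ∂ρ` up to the same geometric error.
  have h1 : |∫ x, f x ∂ρ - c| ≤ α ^ n * k * D := by
    have h2 : ∫ x, f x ∂ρ - c = ∫ x, ((Q^[n] f) x - c) ∂ρ := by
      have h3 : Integrable (Q^[n] f) ρ :=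
        (hi.add (integrable_const c)).congr (ae_of_all _ fun y => by simp)
      rw [integral_sub h3 (integrable_const c), hinv n]
      simp
    rw [h2, hD, ← integral_const_mul]
    exact abs_integral_le_integral_abs.trans (integral_mono hi.abs (hdρ.const_mul _) hc)
  have h2 : |(Q^[n] f) x - ∫ x, f x ∂ρ| ≤ α ^ n * k * (1 + κ * V x) + α ^ n * k * D := by
    have h3 : (Q^[n] f) x - ∫ x, f x ∂ρ = ((Q^[n] f) x - c) - (∫ x, f x ∂ρ - c) := by ring
    rw [h3]
    exact (abs_sub _ _).trans (add_le_add (hc x) h1)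
  refine h2.trans ?_
  have h3 : 1 + κ * V x + D ≤ (1 + κ + D) * V x := by
    have := hV1 x
    nlinarith
  have h4 := mul_le_mul_of_nonneg_left h3 (by positivity : 0 ≤ α ^ n * k)
  linarith

/-! ### The drift function and the acceptance ratio. -/

section Density

variable {E : Type*} {π : E → ℝ}

lemma supNorm_pos [Nonempty E] (hp : ∀ x, 0 < π x) (hb : BddAbove (Set.range π)) :
    0 < supNorm π := by
  obtain ⟨x⟩ := ‹Nonempty E›
  exact (hp x).trans_le (le_ciSup hb x)

lemma one_le_driftW (hp : ∀ x, 0 < π x) (hb : BddAbove (Set.range π)) {τ : ℝ} (hτ : 0 < τ)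
    (x : E) : 1 ≤ driftW π τ x := by
  have : Nonempty E := ⟨x⟩
  have hs := supNorm_pos hp hb
  exact Real.one_le_rpow_of_pos_of_le_one_of_nonpos (div_pos (hp x) hs)
    ((div_le_one hs).2 (le_ciSup hb x)) (by linarith)

lemma continuous_driftW [TopologicalSpace E] (hc : Continuous π) (hp : ∀ x, 0 < π x)
    (hb : BddAbove (Set.range π)) (τ : ℝ) : Continuous (driftW π τ) := by
  refine (hc.div_const _).rpow_const fun x => Or.inl ?_
  have : Nonempty E := ⟨x⟩
  exact (div_pos (hp x) (supNorm_pos hp hb)).ne'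

/-- Inverting the power turns sublevel sets of `W` into subsets of superlevel sets of `π`, the sets
on which smallness is assumed. -/
lemma le_of_driftW_le (hp : ∀ x, 0 < π x) (hb : BddAbove (Set.range π)) {τ : ℝ} (hτ : 0 < τ)
    {x : E} {M : ℝ} (h : driftW π τ x ≤ M) : supNorm π * M ^ (-(1 / τ)) ≤ π x := by
  have : Nonempty E := ⟨x⟩
  have hs := supNorm_pos hp hb
  have hq : 0 < π x / supNorm π := div_pos (hp x) hs
  have h1 : M ^ (-(1 / τ)) ≤ driftW π τ x ^ (-(1 / τ)) :=
    Real.rpow_le_rpow_of_nonpos (Real.rpow_pos_of_pos hq _) h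
      (by have : 0 < 1 / τ := by positivity
          linarith)
  have h2 : driftW π τ x ^ (-(1 / τ)) = π x / supNorm π := by
    rw [driftW, ← Real.rpow_mul hq.le]
    have : -τ * -(1 / τ) = 1 := by field_simp
    rw [this, Real.rpow_one]
  rw [h2, le_div_iff₀ hs] at h1
  linarith

lemma accept_nonneg (hp : ∀ x, 0 < π x) (T : ℝ) (x y : E) : 0 ≤ accept π T x y :=
  le_min zero_le_one
    (div_nonneg (Real.rpow_nonneg (hp y).le _) (Real.rpow_nonneg (hp x).le _))

lemma accept_le_one (T : ℝ) (x y : E) : accept π T x y ≤ 1 := min_le_left _ _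

lemma continuous_accept [TopologicalSpace E] (hc : Continuous π) (hp : ∀ x, 0 < π x) (T : ℝ) :
    Continuous fun z : E × E => accept π T z.1 z.2 := by
  have h : Continuous fun x => π x ^ (1 - 1 / T) := hc.rpow_const fun x => Or.inl (hp x).ne'
  exact continuous_const.min ((h.comp continuous_snd).div (h.comp continuous_fst)
    fun z => (Real.rpow_pos_of_pos (hp z.1) _).ne')

lemma continuous_accept_right [TopologicalSpace E] (hc : Continuous π) (hp : ∀ x, 0 < π x) (T : ℝ) (x : E) :
    Continuous fun y => accept π T x y :=
  (continuous_accept hc hp T).comp (Continuous.prodMk_right x)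

lemma continuous_accept_left [TopologicalSpace E] (hc : Continuous π) (hp : ∀ x, 0 < π x) (T : ℝ) (y : E) :
    Continuous fun x => accept π T x y :=
  (continuous_accept hc hp T).comp (Continuous.prodMk_left y)

end Density

/-! ### Drift and minorisation for the sampler kernel. -/

lemma rpow_integrable_of_one_le {E : Type*} [MeasurableSpace E] {m : Measure E} {W : E → ℝ} (hWm : Measurable W)
    (hW1 : ∀ x, 1 ≤ W x) (hW : Integrable W m) {a : ℝ} (ha : a ∈ Set.Ioc (0 : ℝ) 1) :
    Integrable (fun y => W y ^ a) m := by
  refine hW.mono' (hWm.pow_const a).aestronglyMeasurable (ae_of_all _ fun y => ?_)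
  have h0 : 0 ≤ W y := zero_le_one.trans (hW1 y)
  rw [Real.norm_eq_abs, abs_of_nonneg (Real.rpow_nonneg h0 _)]
  simpa using Real.rpow_le_rpow_of_exponent_le (hW1 y) ha.2

/-- Jensen's inequality turns a drift condition for `W` into one for `W ^ a`. -/
lemma integral_rpow_le_of_drift {E : Type*} [MeasurableSpace E] {m : Measure E} [IsProbabilityMeasure m] {W : E → ℝ}
    (hWm : Measurable W) (hW1 : ∀ x, 1 ≤ W x) (hW : Integrable W m) {a lam b w : ℝ}
    (ha : a ∈ Set.Ioc (0 : ℝ) 1) (hlam : 0 ≤ lam) (hb : 0 ≤ b) (hw : 0 ≤ w)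
    (hd : ∫ y, W y ∂m ≤ lam * w + b) :
    ∫ y, W y ^ a ∂m ≤ lam ^ a * w ^ a + b ^ a := by
  have h0 : ∀ y, 0 ≤ W y := fun y => zero_le_one.trans (hW1 y)
  have h1 : ∫ y, W y ^ a ∂m ≤ (∫ y, W y ∂m) ^ a :=
    (Real.concaveOn_rpow ha.1.le ha.2).le_map_integral
      (Real.continuous_rpow_const ha.1.le).continuousOn isClosed_Ici
      (ae_of_all _ fun y => h0 y) hW (rpow_integrable_of_one_le hWm hW1 hW ha)
  refine h1.trans ((Real.rpow_le_rpow (integral_nonneg h0) hd ha.1.le).trans ?_)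
  rw [← Real.mul_rpow hlam hw]
  exact Real.rpow_add_le_add_rpow (by positivity) hb ha.1.le ha.2

/-- The sublevel sets of the drift function are small for the sampler kernel. -/
lemma samplerKernel_small {E : Type*} [MeasurableSpace E] {π : E → ℝ} {T υ : ℝ}
    {P : Kernel E E} {θ : Measure E} [Nonempty E] (hp : ∀ x, 0 < π x) (hb : BddAbove (Set.range π))
    (hυ : υ ∈ Set.Ioo (0 : ℝ) 1) {τ a : ℝ} (hτ : 0 < τ) (ha : 0 < a)
    (hsmall : ∀ p ∈ Set.Ioo 0 (supNorm π), IsOneSmall P {x | p ≤ π x}) (R : ℝ) :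
    ∃ ε : ℝ, 0 < ε ∧ ∃ ν : Measure E, IsProbabilityMeasure ν ∧
      ∀ x, driftW π τ x ^ a ≤ R → ∀ A, MeasurableSet A →
        ENNReal.ofReal ε * ν A ≤ samplerKernel π T υ P θ x A := by
  -- Making `M > 1` puts the level `supNorm π * M ^ (-(1 / τ))` strictly below `supNorm π`, as the
  -- smallness assumption requires.
  set M : ℝ := max R 1 ^ (1 / a) + 1 with hM
  have hR0 : 0 < max R 1 := lt_max_of_lt_right one_pos
  have hM1 : 1 < M := by have := Real.rpow_pos_of_pos hR0 (1 / a); linarith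
  have hs := supNorm_pos hp hb
  obtain ⟨-, ε, hε, ν, hν, hmin⟩ := hsmall (supNorm π * M ^ (-(1 / τ)))
    ⟨mul_pos hs (Real.rpow_pos_of_pos (by linarith) _), mul_lt_of_lt_one_right hs
      (Real.rpow_lt_one_of_one_lt_of_neg hM1 (neg_neg_of_pos (by positivity)))⟩
  refine ⟨(1 - υ) * ε, mul_pos (by linarith [hυ.2]) hε, ν, hν, fun x hx A hA => ?_⟩
  have h1 := one_le_driftW hp hb hτ x
  have h0 : 0 ≤ driftW π τ x := by linarith
  have hxM : driftW π τ x ≤ M := by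
    have h2 : (driftW π τ x ^ a) ^ (1 / a) ≤ max R 1 ^ (1 / a) :=
      Real.rpow_le_rpow (Real.rpow_nonneg h0 _) (hx.trans (le_max_left _ _)) (by positivity)
    rw [← Real.rpow_mul h0, mul_one_div_cancel ha.ne', Real.rpow_one] at h2
    linarith
  have h2 := hmin x (le_of_driftW_le hp hb hτ hxM) A hA
  rw [ENNReal.ofReal_mul (by linarith [hυ.2]), mul_assoc]
  refine (mul_le_mul_right h2 _).trans ?_
  simp [samplerKernel]

section Sampler

variable {E : Type*} [TopologicalSpace E] [MeasurableSpace E] [BorelSpace E]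
  {π : E → ℝ} {T υ : ℝ} {P : Kernel E E} {θ : Measure E}

lemma integrable_accept_mul (hc : Continuous π) (hp : ∀ x, 0 < π x) (x : E) {h : E → ℝ}
    (hh : Integrable h θ) : Integrable (fun y => accept π T x y * h y) θ :=
  hh.bdd_mul (c := 1) (continuous_accept_right hc hp T x).aestronglyMeasurable
    (ae_of_all _ fun y => by
      rw [Real.norm_eq_abs, abs_of_nonneg (accept_nonneg hp T x y)]; exact accept_le_one T x y)

lemma integrable_accept [IsFiniteMeasure θ] (hc : Continuous π) (hp : ∀ x, 0 < π x) (x : E) :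
    Integrable (fun y => accept π T x y) θ := by
  simpa using integrable_accept_mul (T := T) hc hp x (integrable_const (1 : ℝ) (μ := θ))

lemma isProbabilityMeasure_samplerKernel [IsMarkovKernel P] [IsProbabilityMeasure θ]
    (hc : Continuous π) (hp : ∀ x, 0 < π x) (hυ : υ ∈ Set.Ioo (0 : ℝ) 1) (x : E) :
    IsProbabilityMeasure (samplerKernel π T υ P θ x) := by
  constructor
  have h1 : (∫⁻ y, ENNReal.ofReal (accept π T x y) ∂θ) +
      ∫⁻ y, ENNReal.ofReal (1 - accept π T x y) ∂θ = 1 := by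
    rw [← lintegral_add_left
      (continuous_accept_right hc hp T x).measurable.ennreal_ofReal]
    simp_rw [← ENNReal.ofReal_add (accept_nonneg hp T x _) (sub_nonneg.2 (accept_le_one T x _))]
    simp
  simp only [samplerKernel, interactionKernel, Measure.add_apply, Measure.smul_apply, smul_eq_mul,
    measure_univ, mul_one, withDensity_apply _ MeasurableSet.univ, Measure.restrict_univ, h1]
  rw [← ENNReal.ofReal_add (by linarith [hυ.2]) hυ.1.le]
  simp

variable [PolishSpace E]

/-- Integrals against the sampler kernel. -/
lemma integrable_and_integral_samplerKernel [IsProbabilityMeasure θ] (hc : Continuous π)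
    (hp : ∀ x, 0 < π x) (hυ : υ ∈ Set.Ioo (0 : ℝ) 1) (x : E) {h : E → ℝ}
    (hP : Integrable h (P x)) (hθ : Integrable h θ) :
    Integrable h (samplerKernel π T υ P θ x) ∧
    ∫ y, h y ∂(samplerKernel π T υ P θ x) = (1 - υ) * ∫ y, h y ∂(P x) +
      υ * (∫ y, accept π T x y * h y ∂θ + (∫ y, (1 - accept π T x y) ∂θ) * h x) := by
  have hmeas : Measurable fun y => accept π T x y :=
    (continuous_accept_right hc hp T x).measurable
  have hw : Integrable h (θ.withDensity fun y => ENNReal.ofReal (accept π T x y)) := by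
    rw [integrable_withDensity_iff_integrable_smul' hmeas.ennreal_ofReal
      (ae_of_all _ fun _ => ENNReal.ofReal_lt_top)]
    simpa only [ENNReal.toReal_ofReal (accept_nonneg hp T x _), smul_eq_mul]
      using integrable_accept_mul hc hp x hθ
  have hwi : ∫ y, h y ∂(θ.withDensity fun y => ENNReal.ofReal (accept π T x y))
      = ∫ y, accept π T x y * h y ∂θ := by
    rw [integral_withDensity_eq_integral_toReal_smul hmeas.ennreal_ofReal
      (ae_of_all _ fun _ => ENNReal.ofReal_lt_top)]
    simp only [ENNReal.toReal_ofReal (accept_nonneg hp T x _), smul_eq_mul]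
  set r : ℝ≥0∞ := ∫⁻ y, ENNReal.ofReal (1 - accept π T x y) ∂θ with hr
  have hri : Integrable (fun y => 1 - accept π T x y) θ :=
    (integrable_const 1).sub (integrable_accept hc hp x)
  have hr0 : 0 ≤ᵐ[θ] fun y => 1 - accept π T x y :=
    ae_of_all _ fun y => sub_nonneg.2 (accept_le_one T x y)
  have hrt : r ≠ ∞ := by rw [hr, ← ofReal_integral_eq_lintegral_ofReal hri hr0]; simp
  have hrr : r.toReal = ∫ y, (1 - accept π T x y) ∂θ := by
    rw [hr, ← ofReal_integral_eq_lintegral_ofReal hri hr0,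
      ENNReal.toReal_ofReal (integral_nonneg_of_ae hr0)]
  have hdi : Integrable h (r • Measure.dirac x) :=
    (integrable_dirac (by simp)).smul_measure hrt
  have hK : Integrable h (interactionKernel π T θ x) := hw.add_measure hdi
  have hKi : ∫ y, h y ∂(interactionKernel π T θ x)
      = ∫ y, accept π T x y * h y ∂θ + (∫ y, (1 - accept π T x y) ∂θ) * h x := by
    rw [interactionKernel, integral_add_measure hw hdi, hwi, integral_smul_measure,
      integral_dirac, hrr, smul_eq_mul]
  have h1 : Integrable h (ENNReal.ofReal (1 - υ) • P x) :=
    hP.smul_measure ENNReal.ofReal_ne_top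
  have h2 : Integrable h (ENNReal.ofReal υ • interactionKernel π T θ x) :=
    hK.smul_measure ENNReal.ofReal_ne_top
  refine ⟨h1.add_measure h2, ?_⟩
  rw [samplerKernel, integral_add_measure h1 h2, integral_smul_measure, integral_smul_measure,
    hKi, ENNReal.toReal_ofReal (by linarith [hυ.2]), ENNReal.toReal_ofReal hυ.1.le]
  rfl

/-- The drift condition for the sampler kernel. -/
lemma integral_rpow_samplerKernel_le [IsMarkovKernel P] [IsProbabilityMeasure θ]
    (hc : Continuous π) (hp : ∀ x, 0 < π x) (hυ : υ ∈ Set.Ioo (0 : ℝ) 1) {W : E → ℝ}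
    (hWm : Measurable W) (hW1 : ∀ x, 1 ≤ W x) {a lam b : ℝ} (ha : a ∈ Set.Ioc (0 : ℝ) 1)
    (hlam : 0 ≤ lam) (hb : 0 ≤ b) (hPi : ∀ x, Integrable W (P x))
    (hPd : ∀ x, ∫ y, W y ∂(P x) ≤ lam * W x + b) (hθ : Integrable W θ) (x : E) :
    ∫ y, W y ^ a ∂(samplerKernel π T υ P θ x)
      ≤ ((1 - υ) * lam ^ a + υ) * W x ^ a + (b ^ a + ∫ y, W y ^ a ∂θ) := by
  have h0 : ∀ y, 0 ≤ W y ^ a := fun y => Real.rpow_nonneg (zero_le_one.trans (hW1 y)) _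
  have hθa := rpow_integrable_of_one_le hWm hW1 hθ ha
  rw [(integrable_and_integral_samplerKernel hc hp hυ x
    (rpow_integrable_of_one_le hWm hW1 (hPi x) ha) hθa).2]
  have h1 := integral_rpow_le_of_drift hWm hW1 (hPi x) ha hlam hb
    (zero_le_one.trans (hW1 x)) (hPd x)
  have h2 : ∫ y, accept π T x y * W y ^ a ∂θ ≤ ∫ y, W y ^ a ∂θ :=
    integral_mono (integrable_accept_mul hc hp x hθa) hθa fun y =>
      mul_le_of_le_one_left (h0 y) (accept_le_one T x y)
  have h3 : (∫ y, (1 - accept π T x y) ∂θ) * W x ^ a ≤ W x ^ a := by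
    refine mul_le_of_le_one_left (h0 x) ?_
    have : ∫ y, (1 - accept π T x y) ∂θ ≤ ∫ _, (1 : ℝ) ∂θ :=
      integral_mono ((integrable_const 1).sub (integrable_accept hc hp x)) (integrable_const 1)
        fun y => by have := accept_nonneg hp T x y; simp only; linarith
    simpa using this
  have h4 : 0 ≤ ∫ y, W y ^ a ∂θ := integral_nonneg h0
  have h5 : 0 ≤ b ^ a := Real.rpow_nonneg hb a
  have h6 := mul_le_mul_of_nonneg_left h1 (by linarith [hυ.2] : 0 ≤ 1 - υ)
  have h7 := mul_le_mul_of_nonneg_left (add_le_add h2 h3) hυ.1.le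
  have h8 : υ * ∫ y, W y ^ a ∂θ ≤ ∫ y, W y ^ a ∂θ := mul_le_of_le_one_left h4 hυ.2.le
  have h9 : (1 - υ) * b ^ a ≤ b ^ a := mul_le_of_le_one_left h5 (by linarith [hυ.1])
  linarith

lemma contraction_factor_lt_one (hυ : υ ∈ Set.Ioo (0 : ℝ) 1) {a lam : ℝ} (ha : 0 < a)
    (hlam : lam ∈ Set.Ioo (0 : ℝ) 1) : (1 - υ) * lam ^ a + υ < 1 := by
  have h1 : lam ^ a < 1 := Real.rpow_lt_one hlam.1.le hlam.2 ha
  nlinarith [hυ.2]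

end Sampler

/-! ### The transition operator on continuous functions dominated by `W ^ a`. -/

/-- The transition operator `f ↦ P_θ f`. -/
noncomputable def samplerOp {E : Type*} [MeasurableSpace E] (π : E → ℝ) (T υ : ℝ) (P : Kernel E E)
    (θ : Measure E) (f : E → ℝ) (x : E) : ℝ :=
  ∫ y, f y ∂(samplerKernel π T υ P θ x)

/-- The tail estimate behind all truncations in `W`: above level `M`, the power `W ^ a` is a small
multiple of `W` when `a < 1`. -/
lemma rpow_le_mul_of_le {M w a : ℝ} (hM : 0 < M) (hw : M ≤ w) (ha : a ≤ 1) :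
    w ^ a ≤ M ^ (a - 1) * w := by
  have hw0 : 0 < w := hM.trans_le hw
  calc w ^ a = w ^ (a - 1) * w := by rw [Real.rpow_sub_one hw0.ne']; field_simp
    _ ≤ M ^ (a - 1) * w := mul_le_mul_of_nonneg_right
        (Real.rpow_le_rpow_of_nonpos hM hw (by linarith)) hw0.le

lemma integrable_of_abs_le_rpow {E : Type*} [MeasurableSpace E] {m : Measure E} {W f : E → ℝ}
    (hWm : Measurable W) (hW1 : ∀ x, 1 ≤ W x) (hW : Integrable W m) {a C : ℝ}
    (ha : a ∈ Set.Ioc (0 : ℝ) 1) (hf : Measurable f) (hfC : ∀ x, |f x| ≤ C * W x ^ a) :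
    Integrable f m :=
  ((rpow_integrable_of_one_le hWm hW1 hW ha).const_mul C).mono' hf.aestronglyMeasurable
    (ae_of_all _ fun x => by simpa using hfC x)

lemma nonneg_of_abs_le_rpow {E : Type*} [Nonempty E] {W f : E → ℝ} (hW1 : ∀ x, 1 ≤ W x)
    {a C : ℝ} (hfC : ∀ x, |f x| ≤ C * W x ^ a) : 0 ≤ C := by
  obtain ⟨x⟩ := ‹Nonempty E›
  exact nonneg_of_mul_nonneg_left ((abs_nonneg _).trans (hfC x))
    (Real.rpow_pos_of_pos (zero_lt_one.trans_le (hW1 x)) _)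

section

variable {E : Type*} [TopologicalSpace E] [MeasurableSpace E] [BorelSpace E]
  {π : E → ℝ} {T υ : ℝ} {P : Kernel E E} {θ : Measure E}

/-- A Feller kernel with a drift condition for `W` maps continuous functions that are dominated
by `W ^ a`, `a < 1`, to continuous functions. -/
lemma IsFeller.continuous_integral [IsMarkovKernel P] (hF : IsFeller P) {W : E → ℝ}
    (hWc : Continuous W)
    (hW1 : ∀ x, 1 ≤ W x) {lam b : ℝ} (hlam : 0 ≤ lam) (hb : 0 ≤ b)
    (hPi : ∀ x, Integrable W (P x)) (hPd : ∀ x, ∫ y, W y ∂(P x) ≤ lam * W x + b)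
    {a C : ℝ} (ha : a ∈ Set.Ioo (0 : ℝ) 1) {f : E → ℝ} (hf : Continuous f)
    (hfC : ∀ x, |f x| ≤ C * W x ^ a) : Continuous fun x => ∫ y, f y ∂(P x) := by
  have hW0 : ∀ x, 0 < W x := fun x => zero_lt_one.trans_le (hW1 x)
  refine continuous_iff_continuousAt.2 fun x₀ => ?_
  have : Nonempty E := ⟨x₀⟩
  have hC := nonneg_of_abs_le_rpow hW1 hfC
  refine continuousAt_of_locally_uniform_approx_of_continuousAt fun u hu => ?_
  obtain ⟨ε, hε, hεu⟩ := Metric.mem_uniformity_dist.1 hu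
  set L := lam * (W x₀ + 1) + b with hL
  have hL0 : 0 ≤ L := by have := hW0 x₀; positivity
  have hlim : Tendsto (fun M : ℝ => C * M ^ (a - 1) * L) atTop (𝓝 0) := by
    have h := tendsto_rpow_neg_atTop (y := 1 - a) (by linarith [ha.2])
    rw [neg_sub] at h
    simpa using (h.const_mul C).mul_const L
  obtain ⟨M, hMε, hM1⟩ := ((hlim.eventually (gt_mem_nhds hε)).and (eventually_ge_atTop 1)).exists
  have hM0 : 0 < M := by linarith
  -- This level bounds `|f|` on `{W ≤ M}`, so clipping `f` at `±B` changes it only where `W > M`. By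
  -- the drift condition the resulting error in `P f` is uniform near `x₀`, where `W < W x₀ + 1`.
  set B := C * M ^ a with hB
  have hB0 : 0 ≤ B := by positivity
  set g : E → ℝ := fun y => max (-B) (min (f y) B) with hg
  have hgc : Continuous g := continuous_const.max (hf.min continuous_const)
  have hgb : ∀ y, |g y| ≤ B := fun y =>
    abs_le.2 ⟨le_max_left _ _, max_le (by linarith) (min_le_right _ _)⟩
  have hfg : ∀ y, |f y - g y| ≤ C * M ^ (a - 1) * W y := by
    intro y
    rcases le_total (W y) M with h | h
    · have h1 : |f y| ≤ B := (hfC y).trans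
        (mul_le_mul_of_nonneg_left (Real.rpow_le_rpow (hW0 y).le h ha.1.le) hC)
      have h2 : g y = f y := by
        simp only [hg]
        rw [min_eq_left (abs_le.1 h1).2, max_eq_right (abs_le.1 h1).1]
      rw [h2, sub_self, abs_zero]
      have := hW0 y
      positivity
    · have h1 : |f y - g y| ≤ |f y| := by
        simp only [hg]
        rcases le_total (f y) B with h3 | h3
        · rw [min_eq_left h3]
          rcases le_total (-B) (f y) with h4 | h4
          · rw [max_eq_right h4]; simp
          · rw [max_eq_left h4, abs_of_nonpos (by linarith), abs_of_nonpos (by linarith)]; linarith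
        · rw [min_eq_right h3, max_eq_right (by linarith), abs_of_nonneg (by linarith),
            abs_of_nonneg (by linarith)]; linarith
      refine (h1.trans (hfC y)).trans ?_
      rw [mul_assoc]
      exact mul_le_mul_of_nonneg_left (rpow_le_mul_of_le hM0 h ha.2.le) hC
  have hfi : ∀ x, Integrable f (P x) := fun x =>
    integrable_of_abs_le_rpow hWc.measurable hW1 (hPi x) ⟨ha.1, ha.2.le⟩ hf.measurable hfC
  have hgi : ∀ x, Integrable g (P x) := fun x =>
    (integrable_const B).mono' hgc.measurable.aestronglyMeasurable
      (ae_of_all _ fun y => by simpa using hgb y)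
  refine ⟨{x | W x < W x₀ + 1}, hWc.continuousAt.eventually (gt_mem_nhds (by linarith)),
    fun x => ∫ y, g y ∂(P x), (hF g hgc ⟨B, hgb⟩).continuousAt, fun x hx => hεu ?_⟩
  rw [Real.dist_eq, ← integral_sub (hfi x) (hgi x)]
  refine lt_of_le_of_lt ?_ hMε
  refine (abs_integral_le_integral_abs.trans (integral_mono ((hfi x).sub (hgi x)).abs
    ((hPi x).const_mul _) hfg)).trans ?_
  rw [integral_const_mul]
  refine mul_le_mul_of_nonneg_left ((hPd x).trans ?_) (by positivity)
  have hx' : W x ≤ W x₀ + 1 := le_of_lt hx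
  have := mul_le_mul_of_nonneg_left hx' hlam
  linarith

lemma continuous_integral_accept_mul (hc : Continuous π) (hp : ∀ x, 0 < π x)
    [FirstCountableTopology E]
    {f : E → ℝ} (hf : Integrable f θ) : Continuous fun x => ∫ y, accept π T x y * f y ∂θ := by
  refine continuous_of_dominated (bound := fun y => |f y|)
    (fun x => (integrable_accept_mul hc hp x hf).aestronglyMeasurable)
    (fun x => ae_of_all _ fun y => ?_) hf.abs
    (ae_of_all _ fun y => (continuous_accept_left hc hp T y).mul continuous_const)
  rw [Real.norm_eq_abs, abs_mul, abs_of_nonneg (accept_nonneg hp T x y)]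
  exact mul_le_of_le_one_left (abs_nonneg _) (accept_le_one T x y)

variable [PolishSpace E]

/-- `P_θ` maps continuous functions dominated by `W ^ a` to continuous functions. -/
lemma continuous_samplerOp [IsMarkovKernel P] [IsProbabilityMeasure θ]
    (hc : Continuous π) (hp : ∀ x, 0 < π x) (hυ : υ ∈ Set.Ioo (0 : ℝ) 1) (hF : IsFeller P)
    {W : E → ℝ} (hWc : Continuous W) (hW1 : ∀ x, 1 ≤ W x) {a lam b : ℝ}
    (ha : a ∈ Set.Ioo (0 : ℝ) 1) (hlam : 0 ≤ lam) (hb : 0 ≤ b) (hPi : ∀ x, Integrable W (P x))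
    (hPd : ∀ x, ∫ y, W y ∂(P x) ≤ lam * W x + b) (hθ : Integrable W θ) {f : E → ℝ}
    (hf : Continuous f) {C : ℝ} (hfC : ∀ x, |f x| ≤ C * W x ^ a) :
    Continuous (samplerOp π T υ P θ f) := by
  have ha' : a ∈ Set.Ioc (0 : ℝ) 1 := ⟨ha.1, ha.2.le⟩
  have hfi : ∀ x, Integrable f (P x) := fun x =>
    integrable_of_abs_le_rpow hWc.measurable hW1 (hPi x) ha' hf.measurable hfC
  have hfθ : Integrable f θ :=
    integrable_of_abs_le_rpow hWc.measurable hW1 hθ ha' hf.measurable hfC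
  have heq : samplerOp π T υ P θ f = fun x => (1 - υ) * ∫ y, f y ∂(P x) +
      υ * (∫ y, accept π T x y * f y ∂θ + (1 - ∫ y, accept π T x y * 1 ∂θ) * f x) := by
    funext x
    rw [samplerOp, (integrable_and_integral_samplerKernel hc hp hυ x (hfi x) hfθ).2,
      integral_sub (integrable_const 1) (integrable_accept hc hp x)]
    simp
  rw [heq]
  have h1 := hF.continuous_integral hWc hW1 hlam hb hPi hPd ha hf hfC
  have h2 := continuous_integral_accept_mul (T := T) hc hp hfθ
  have h3 := continuous_integral_accept_mul (T := T) hc hp (integrable_const (1 : ℝ) (μ := θ))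
  exact (continuous_const.mul h1).add
    (continuous_const.mul (h2.add ((continuous_const.sub h3).mul hf)))

/-- `P_θ` preserves the class of functions dominated by a multiple of `W ^ a`. -/
lemma abs_samplerOp_le [IsMarkovKernel P] [IsProbabilityMeasure θ] [Nonempty E]
    (hc : Continuous π) (hp : ∀ x, 0 < π x) (hυ : υ ∈ Set.Ioo (0 : ℝ) 1)
    {W : E → ℝ} (hWm : Measurable W) (hW1 : ∀ x, 1 ≤ W x) {a lam b : ℝ}
    (ha : a ∈ Set.Ioc (0 : ℝ) 1) (hlam : 0 ≤ lam) (hb : 0 ≤ b) (hPi : ∀ x, Integrable W (P x))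
    (hPd : ∀ x, ∫ y, W y ∂(P x) ≤ lam * W x + b) (hθ : Integrable W θ) {f : E → ℝ}
    {C : ℝ} (hf : Measurable f) (hfC : ∀ x, |f x| ≤ C * W x ^ a) (x : E) :
    |samplerOp π T υ P θ f x|
      ≤ C * (((1 - υ) * lam ^ a + υ) + (b ^ a + ∫ y, W y ^ a ∂θ)) * W x ^ a := by
  have hC := nonneg_of_abs_le_rpow hW1 hfC
  have hV1 : 1 ≤ W x ^ a := Real.one_le_rpow (hW1 x) ha.1.le
  have hV0 : ∀ y, 0 ≤ W y ^ a := fun y => Real.rpow_nonneg (zero_le_one.trans (hW1 y)) _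
  have hWi := (integrable_and_integral_samplerKernel (T := T) hc hp hυ x (hPi x) hθ).1
  have hi := rpow_integrable_of_one_le hWm hW1 hWi ha
  have hfi := integrable_of_abs_le_rpow hWm hW1 hWi ha hf hfC
  refine (abs_integral_le_integral_abs.trans
    (integral_mono hfi.abs (hi.const_mul C) hfC)).trans ?_
  rw [integral_const_mul, mul_assoc C]
  refine mul_le_mul_of_nonneg_left
    ((integral_rpow_samplerKernel_le hc hp hυ hWm hW1 ha hlam hb hPi hPd hθ x).trans ?_) hC
  have h5 : 0 ≤ b ^ a + ∫ y, W y ^ a ∂θ :=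
    add_nonneg (Real.rpow_nonneg hb a) (integral_nonneg hV0)
  nlinarith

end

/-! ### The tempered measure, the target and reversibility. -/

section

variable {E : Type*} {π : E → ℝ} {T : ℝ}

lemma tempered_density_mul (hp : ∀ x, 0 < π x) {Z : ℝ} (hZ : Z ≠ 0) (x : E) (r : ℝ) :
    Z * (π x ^ (1 / T) / Z * (π x ^ (1 - 1 / T) * r)) = r * π x := by
  have h : π x ^ (1 / T) * π x ^ (1 - 1 / T) = π x := by
    rw [← Real.rpow_add (hp x)]; simp
  calc Z * (π x ^ (1 / T) / Z * (π x ^ (1 - 1 / T) * r))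
      = (π x ^ (1 / T) * π x ^ (1 - 1 / T)) * r := by field_simp
    _ = r * π x := by rw [h, mul_comm]

lemma rpow_le_supNorm_rpow (hp : ∀ x, 0 < π x) (hb : BddAbove (Set.range π)) (hT1 : 1 < T)
    (x : E) : π x ^ (1 - 1 / T) ≤ supNorm π ^ (1 - 1 / T) :=
  Real.rpow_le_rpow (hp x).le (le_ciSup hb x)
    (sub_nonneg.2 ((div_le_one (by linarith)).2 hT1.le))

/-- Detailed balance: relative to `θ⋆ ⊗ θ⋆` the target-weighted acceptance rate is symmetric in `x`
and `y`. -/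
lemma rpow_mul_accept (hp : ∀ x, 0 < π x) (x y : E) :
    π x ^ (1 - 1 / T) * accept π T x y = min (π x ^ (1 - 1 / T)) (π y ^ (1 - 1 / T)) := by
  have h := Real.rpow_pos_of_pos (hp x) (1 - 1 / T)
  rw [accept, mul_min_of_nonneg _ _ h.le, mul_one, mul_div_cancel₀ _ h.ne']

variable [MeasurableSpace E] {μ : Measure E}

lemma isProbabilityMeasure_targetMeasure (h : ∫⁻ x, ENNReal.ofReal (π x) ∂μ = 1) :
    IsProbabilityMeasure (targetMeasure μ π) :=
  ⟨by rw [targetMeasure, withDensity_apply _ MeasurableSet.univ, Measure.restrict_univ, h]⟩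

lemma integral_rpow_pos (hp : ∀ x, 0 < π x) (hμ : μ ≠ 0)
    (hT : Integrable (fun x => π x ^ (1 / T)) μ) : 0 < ∫ x, π x ^ (1 / T) ∂μ := by
  rw [integral_pos_iff_support_of_nonneg (fun x => Real.rpow_nonneg (hp x).le _) hT]
  have : Function.support (fun x => π x ^ (1 / T)) = Set.univ :=
    Set.eq_univ_of_forall fun x => (Real.rpow_pos_of_pos (hp x) _).ne'
  rw [this]
  exact Measure.measure_univ_pos.2 hμ

lemma isProbabilityMeasure_temperedMeasure (hp : ∀ x, 0 < π x) (hμ : μ ≠ 0)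
    (hT : Integrable (fun x => π x ^ (1 / T)) μ) :
    IsProbabilityMeasure (temperedMeasure μ π T) := by
  have hZ := integral_rpow_pos hp hμ hT
  refine ⟨?_⟩
  rw [temperedMeasure, withDensity_apply _ MeasurableSet.univ, Measure.restrict_univ,
    ← ofReal_integral_eq_lintegral_ofReal (hT.div_const _)
      (ae_of_all _ fun x => div_nonneg (Real.rpow_nonneg (hp x).le _) hZ.le),
    integral_div, div_self hZ.ne', ENNReal.ofReal_one]

lemma integral_integral_of_invariant {P : Kernel E E} [IsMarkovKernel P] {ρ : Measure E} (hinv : P.Invariant ρ)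
    {f : E → ℝ} (hf : Integrable f ρ) :
    Integrable (fun x => ∫ y, f y ∂(P x)) ρ ∧ ∫ x, ∫ y, f y ∂(P x) ∂ρ = ∫ x, f x ∂ρ := by
  have h : P ∘ₖ Kernel.const Unit ρ = Kernel.const Unit ρ := by rw [Kernel.comp_const, hinv.def]
  have hf' : Integrable f ((P ∘ₖ Kernel.const Unit ρ) ()) := by rwa [h, Kernel.const_apply]
  have h1 := hf'.integral_comp
  have h2 := Kernel.integral_comp hf'
  rw [h] at h2
  simp only [Kernel.const_apply] at h1 h2
  exact ⟨h1, h2.symm⟩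

end

section

variable {E : Type*} [TopologicalSpace E] [MeasurableSpace E] [BorelSpace E]
  {μ : Measure E} {π : E → ℝ} {T υ : ℝ} {P : Kernel E E}

lemma integrable_targetMeasure_iff (hc : Continuous π) (hp : ∀ x, 0 < π x) {f : E → ℝ} :
    Integrable f (targetMeasure μ π) ↔ Integrable (fun x => f x * π x) μ := by
  rw [targetMeasure, integrable_withDensity_iff_integrable_smul' hc.measurable.ennreal_ofReal
    (ae_of_all _ fun _ => ENNReal.ofReal_lt_top)]
  simp only [ENNReal.toReal_ofReal (hp _).le, smul_eq_mul, mul_comm]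

lemma integral_targetMeasure (hc : Continuous π) (hp : ∀ x, 0 < π x) (f : E → ℝ) :
    ∫ x, f x ∂(targetMeasure μ π) = ∫ x, f x * π x ∂μ := by
  rw [targetMeasure, integral_withDensity_eq_integral_toReal_smul hc.measurable.ennreal_ofReal
    (ae_of_all _ fun _ => ENNReal.ofReal_lt_top)]
  simp only [ENNReal.toReal_ofReal (hp _).le, smul_eq_mul, mul_comm]

lemma measurable_tempered_density (hc : Continuous π) (Z : ℝ) :
    Measurable fun x => ENNReal.ofReal (π x ^ (1 / T) / Z) :=
  ((hc.measurable.pow_const _).div_const _).ennreal_ofReal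

lemma integrable_temperedMeasure_iff (hc : Continuous π) (hp : ∀ x, 0 < π x) {f : E → ℝ} :
    Integrable f (temperedMeasure μ π T) ↔
      Integrable (fun x => π x ^ (1 / T) / (∫ y, π y ^ (1 / T) ∂μ) * f x) μ := by
  have hZ : 0 ≤ ∫ x, π x ^ (1 / T) ∂μ := integral_nonneg fun x => Real.rpow_nonneg (hp x).le _
  rw [temperedMeasure, integrable_withDensity_iff_integrable_smul'
    (measurable_tempered_density hc _) (ae_of_all _ fun _ => ENNReal.ofReal_lt_top)]
  simp only [ENNReal.toReal_ofReal (div_nonneg (Real.rpow_nonneg (hp _).le _) hZ), smul_eq_mul]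

lemma integral_temperedMeasure (hc : Continuous π) (hp : ∀ x, 0 < π x) (f : E → ℝ) :
    ∫ x, f x ∂(temperedMeasure μ π T)
      = ∫ x, π x ^ (1 / T) / (∫ y, π y ^ (1 / T) ∂μ) * f x ∂μ := by
  have hZ : 0 ≤ ∫ x, π x ^ (1 / T) ∂μ := integral_nonneg fun x => Real.rpow_nonneg (hp x).le _
  rw [temperedMeasure, integral_withDensity_eq_integral_toReal_smul
    (measurable_tempered_density hc _) (ae_of_all _ fun _ => ENNReal.ofReal_lt_top)]
  simp only [ENNReal.toReal_ofReal (div_nonneg (Real.rpow_nonneg (hp _).le _) hZ), smul_eq_mul]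

/-- The target is the tempered measure reweighted by `π ^ (1 - 1 / T)`. -/
lemma integral_targetMeasure_eq_tempered (hc : Continuous π) (hp : ∀ x, 0 < π x) (hμ : μ ≠ 0)
    (hT : Integrable (fun x => π x ^ (1 / T)) μ) (f : E → ℝ) :
    ∫ x, f x ∂(targetMeasure μ π) = (∫ y, π y ^ (1 / T) ∂μ) *
      ∫ x, π x ^ (1 - 1 / T) * f x ∂(temperedMeasure μ π T) := by
  have hZ := integral_rpow_pos hp hμ hT
  rw [integral_targetMeasure hc hp, integral_temperedMeasure hc hp, ← integral_const_mul]
  exact integral_congr_ae (ae_of_all _ fun x => (tempered_density_mul hp hZ.ne' x (f x)).symm)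

/-- The density of the target with respect to the tempered measure is a multiple of `π ^ (1 - 1 /
T)`, hence bounded. -/
lemma integrable_targetMeasure_of_tempered (hc : Continuous π) (hp : ∀ x, 0 < π x)
    (hb : BddAbove (Set.range π)) (hT1 : 1 < T) (hμ : μ ≠ 0)
    (hT : Integrable (fun x => π x ^ (1 / T)) μ) {f : E → ℝ}
    (hf : Integrable f (temperedMeasure μ π T)) : Integrable f (targetMeasure μ π) := by
  have hZ := integral_rpow_pos hp hμ hT
  have h1 : Integrable (fun x => π x ^ (1 - 1 / T) * f x) (temperedMeasure μ π T) :=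
    hf.bdd_mul (c := supNorm π ^ (1 - 1 / T)) (hc.measurable.pow_const _).aestronglyMeasurable
      (ae_of_all _ fun x => by
        rw [Real.norm_eq_abs, abs_of_nonneg (Real.rpow_nonneg (hp x).le _)]
        exact rpow_le_supNorm_rpow hp hb hT1 x)
  rw [integrable_targetMeasure_iff hc hp]
  rw [integrable_temperedMeasure_iff hc hp] at h1
  exact (h1.const_mul _).congr (ae_of_all _ fun x => tempered_density_mul hp hZ.ne' x (f x))

/-- Reversibility of the interaction step: the antisymmetric flux vanishes. -/
lemma integral_integral_accept_mul_sub [PolishSpace E] (hc : Continuous π) (hp : ∀ x, 0 < π x)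
    (hb : BddAbove (Set.range π)) (hT1 : 1 < T) (hμ : μ ≠ 0)
    (hT : Integrable (fun x => π x ^ (1 / T)) μ) {f : E → ℝ}
    (hf : Integrable f (temperedMeasure μ π T)) :
    ∫ x, ∫ y, accept π T x y * (f y - f x) ∂(temperedMeasure μ π T) ∂(targetMeasure μ π) = 0 := by
  have := isProbabilityMeasure_temperedMeasure hp hμ hT
  set θ := temperedMeasure μ π T
  set q : E → ℝ := fun x => π x ^ (1 - 1 / T) with hq
  have hqc : Continuous q := hc.rpow_const fun x => Or.inl (hp x).ne'
  have hq0 : ∀ x, 0 ≤ q x := fun x => Real.rpow_nonneg (hp x).le _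
  set F : E → E → ℝ := fun x y => min (q x) (q y) * (f y - f x) with hF
  have hFi : Integrable (Function.uncurry F) (θ.prod θ) := by
    have h1 : Integrable (fun z : E × E => f z.2 - f z.1) (θ.prod θ) :=
      (hf.comp_snd θ).sub (hf.comp_fst θ)
    refine h1.bdd_mul (c := supNorm π ^ (1 - 1 / T))
      (f := fun z : E × E => min (q z.1) (q z.2))
      ((hqc.comp continuous_fst).min (hqc.comp continuous_snd)).aestronglyMeasurable
      (ae_of_all _ fun z => ?_)
    rw [Real.norm_eq_abs, abs_of_nonneg (le_min (hq0 _) (hq0 _))]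
    exact (min_le_left _ _).trans (rpow_le_supNorm_rpow hp hb hT1 z.1)
  have hswap := integral_integral_swap hFi
  -- `F` is antisymmetric; with Fubini its double integral equals its own negative.
  have hanti : ∫ y, ∫ x, F x y ∂θ ∂θ = - ∫ x, ∫ y, F x y ∂θ ∂θ := by
    rw [← integral_neg]
    refine integral_congr_ae (ae_of_all _ fun y => ?_)
    simp only
    rw [← integral_neg]
    exact integral_congr_ae (ae_of_all _ fun x => by simp only [hF, min_comm (q x)]; ring)
  rw [integral_targetMeasure_eq_tempered hc hp hμ hT]
  have h0 : ∫ x, ∫ y, F x y ∂θ ∂θ = 0 := by linarith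
  have h1 : ∫ x, q x * ∫ y, accept π T x y * (f y - f x) ∂θ ∂θ = ∫ x, ∫ y, F x y ∂θ ∂θ := by
    refine integral_congr_ae (ae_of_all _ fun x => ?_)
    simp only
    rw [← integral_const_mul]
    exact integral_congr_ae (ae_of_all _ fun y => by
      simp only [hF, ← mul_assoc, hq, rpow_mul_accept hp])
  rw [h1, h0, mul_zero]

/-- The target is invariant for the sampler kernel at the tempered measure. -/
lemma integral_samplerOp_tempered [PolishSpace E] [IsMarkovKernel P] (hc : Continuous π)
    (hp : ∀ x, 0 < π x)
    (hb : BddAbove (Set.range π)) (hT1 : 1 < T) (hμ : μ ≠ 0)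
    (hT : Integrable (fun x => π x ^ (1 / T)) μ) (hυ : υ ∈ Set.Ioo (0 : ℝ) 1)
    (hinv : P.Invariant (targetMeasure μ π)) {f : E → ℝ}
    (hfP : ∀ x, Integrable f (P x)) (hf : Integrable f (temperedMeasure μ π T))
    (hQ : Integrable (samplerOp π T υ P (temperedMeasure μ π T) f) (targetMeasure μ π)) :
    ∫ x, samplerOp π T υ P (temperedMeasure μ π T) f x ∂(targetMeasure μ π)
      = ∫ x, f x ∂(targetMeasure μ π) := by
  have := isProbabilityMeasure_temperedMeasure hp hμ hT
  have hfρ := integrable_targetMeasure_of_tempered hc hp hb hT1 hμ hT hf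
  obtain ⟨hPi, hPe⟩ := integral_integral_of_invariant hinv hfρ
  set θ := temperedMeasure μ π T
  set G : E → ℝ := fun x => ∫ y, accept π T x y * (f y - f x) ∂θ with hG
  have heq : ∀ x, samplerOp π T υ P θ f x = (1 - υ) * ∫ y, f y ∂(P x) + υ * f x + υ * G x := by
    intro x
    rw [samplerOp, (integrable_and_integral_samplerKernel hc hp hυ x (hfP x) hf).2,
      integral_sub (integrable_const 1) (integrable_accept hc hp x)]
    have : G x = ∫ y, accept π T x y * f y ∂θ - (∫ y, accept π T x y ∂θ) * f x := by
      simp only [hG, mul_sub]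
      rw [integral_sub (integrable_accept_mul hc hp x hf)
        ((integrable_accept hc hp x).mul_const _), integral_mul_const]
    rw [this]
    simp
    ring
  have h1 : Integrable (fun x => (1 - υ) * ∫ y, f y ∂(P x) + υ * f x) (targetMeasure μ π) :=
    (hPi.const_mul _).add (hfρ.const_mul _)
  -- Integrability of the flux term is read off from the decomposition `heq`, all other terms being
  -- integrable.
  have h2 : Integrable (fun x => υ * G x) (targetMeasure μ π) :=
    (hQ.sub h1).congr (ae_of_all _ fun x => by simp [heq])
  simp_rw [heq]
  rw [integral_add h1 h2, integral_add (hPi.const_mul _) (hfρ.const_mul _), integral_const_mul,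
    integral_const_mul, integral_const_mul, hPe,
    integral_integral_accept_mul_sub hc hp hb hT1 hμ hT hf]
  ring

end

/-! ### Path averages of a process with drift. -/

lemma summable_succ_rpow {a : ℝ} (ha : a < 1) :
    Summable fun k : ℕ => ((k : ℝ) + 1) ^ (a - 1) / ((k : ℝ) + 1) := by
  have h : Summable fun k : ℕ => (k : ℝ) ^ (a - 2) := Real.summable_nat_rpow.2 (by linarith)
  refine ((summable_nat_add_iff 1).2 h).congr fun k => ?_
  have hk : (0 : ℝ) < (k : ℝ) + 1 := by positivity
  push_cast
  rw [← Real.rpow_sub_one hk.ne']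
  congr 1; ring

/-- Weighted averages of a sequence that is bounded in `L¹` vanish when the weights decay
polynomially. -/
lemma ae_tendsto_cesaroAvg_rpow_mul {Ω : Type*} [MeasurableSpace Ω] {Pr : Measure Ω}
    {u : ℕ → Ω → ℝ} (hu0 : ∀ k ω, 0 ≤ u k ω) (hui : ∀ k, Integrable (u k) Pr) {B : ℝ}
    (hB : ∀ k, ∫ ω, u k ω ∂Pr ≤ B) {a : ℝ} (ha : a < 1) :
    ∀ᵐ ω ∂Pr, Tendsto (cesaroAvg fun k => ((k : ℝ) + 1) ^ (a - 1) * u k ω) atTop (𝓝 0) := by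
  set w : ℕ → ℝ := fun k => ((k : ℝ) + 1) ^ (a - 1) / ((k : ℝ) + 1) with hw
  have hw0 : ∀ k, 0 ≤ w k := fun k => by positivity
  have hwB : Summable fun k => w k * B := (summable_succ_rpow ha).mul_right B
  -- By Tonelli the series has finite expectation, so it converges almost surely and Kronecker's
  -- lemma applies pathwise.
  have hlt : ∫⁻ ω, ∑' k, ENNReal.ofReal (w k * u k ω) ∂Pr ≠ ∞ := by
    rw [lintegral_tsum fun k => ((hui k).const_mul (w k)).aestronglyMeasurable.aemeasurable.ennreal_ofReal]
    have h1 : ∀ k, ∫⁻ ω, ENNReal.ofReal (w k * u k ω) ∂Pr ≤ ENNReal.ofReal (w k * B) := fun k => by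
      rw [← ofReal_integral_eq_lintegral_ofReal ((hui k).const_mul (w k))
        (ae_of_all _ fun ω => mul_nonneg (hw0 k) (hu0 k ω)), integral_const_mul]
      exact ENNReal.ofReal_le_ofReal (mul_le_mul_of_nonneg_left (hB k) (hw0 k))
    exact ne_top_of_le_ne_top hwB.tsum_ofReal_ne_top (ENNReal.tsum_le_tsum h1)
  have hae := ae_lt_top' (AEMeasurable.tsum fun k =>
    ((hui k).const_mul (w k)).aestronglyMeasurable.aemeasurable.ennreal_ofReal) hlt
  filter_upwards [hae] with ω hω
  have hs := ENNReal.summable_toReal hω.ne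
  simp only [ENNReal.toReal_ofReal (mul_nonneg (hw0 _) (hu0 _ ω))] at hs
  refine tendsto_cesaroAvg_of_tendsto_sum_div (l := ∑' k, w k * u k ω)
    (hs.hasSum.tendsto_sum_nat.congr fun n => Finset.sum_congr rfl fun k _ => ?_)
  simp only [hw]; ring

/-- An `E`-valued process whose conditional one-step laws `M n` satisfy a drift condition towards
the sublevel sets of `W`, up to random terms `c n` of bounded mean. -/
structure IsDriftedChain {Ω E : Type*} [MeasurableSpace Ω] [MeasurableSpace E] (Pr : Measure Ω)
    (ℱ : Filtration ℕ (inferInstance : MeasurableSpace Ω)) (X : ℕ → Ω → E)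
    (M : ℕ → Ω → Measure E) (W : E → ℝ) (γ : ℝ) (c : ℕ → Ω → ℝ) : Prop where
  adapted : ∀ n, Measurable[ℱ n] (X n)
  prob : ∀ n ω, IsProbabilityMeasure (M n ω)
  condExp_eq : ∀ n : ℕ, ∀ f : E → ℝ, Measurable f → (∃ C : ℝ, ∀ x, |f x| ≤ C) →
    Pr[fun ω => f (X (n + 1) ω) | ℱ n] =ᵐ[Pr] fun ω => ∫ y, f y ∂(M n ω)
  meas_W : Measurable W
  one_le_W : ∀ x, 1 ≤ W x
  integrable_W : ∀ n ω, Integrable W (M n ω)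
  drift : ∀ n ω, ∫ y, W y ∂(M n ω) ≤ γ * W (X n ω) + c n ω
  nonneg_rate : 0 ≤ γ
  rate_lt_one : γ < 1
  nonneg_c : ∀ n ω, 0 ≤ c n ω
  integrable_c : ∀ n, Integrable (c n) Pr
  bdd_c : ∃ C, ∀ n, ∫ ω, c n ω ∂Pr ≤ C
  initial : Integrable (fun ω => W (X 0 ω)) Pr

namespace IsDriftedChain

variable {Ω E : Type*} [MeasurableSpace Ω] [MeasurableSpace E] {Pr : Measure Ω}
  {ℱ : Filtration ℕ (inferInstance : MeasurableSpace Ω)}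
  {X : ℕ → Ω → E} {M : ℕ → Ω → Measure E} {W : E → ℝ} {γ : ℝ} {c : ℕ → Ω → ℝ}

lemma measurable_comp (H : IsDriftedChain Pr ℱ X M W γ c) {f : E → ℝ} (hf : Measurable f) (n : ℕ) :
    Measurable fun ω => f (X n ω) :=
  hf.comp ((H.adapted n).mono (ℱ.le n) le_rfl)

variable [IsProbabilityMeasure Pr]

/-- The conditional law is prescribed on bounded functions only, so the drift inequality is applied
to `min W N` and passed to the limit by monotone convergence. Integrability at time `n + 1` is part
of the conclusion. -/
lemma integrable_succ (H : IsDriftedChain Pr ℱ X M W γ c) {n : ℕ}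
    (hn : Integrable (fun ω => W (X n ω)) Pr) :
    Integrable (fun ω => W (X (n + 1) ω)) Pr ∧
      ∫ ω, W (X (n + 1) ω) ∂Pr ≤ ∫ ω, (γ * W (X n ω) + c n ω) ∂Pr := by
  have hi : Integrable (fun ω => γ * W (X n ω) + c n ω) Pr :=
    (hn.const_mul γ).add (H.integrable_c n)
  have hW0 : ∀ x, 0 ≤ W x := fun x => zero_le_one.trans (H.one_le_W x)
  set D := ∫ ω, (γ * W (X n ω) + c n ω) ∂Pr with hD
  have hD0 : 0 ≤ D := integral_nonneg fun ω =>
    add_nonneg (mul_nonneg H.nonneg_rate (hW0 _)) (H.nonneg_c n ω)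
  have hbound : ∀ N : ℕ, ∫⁻ ω, ENNReal.ofReal (min (W (X (n + 1) ω)) N) ∂Pr ≤ ENNReal.ofReal D := by
    intro N
    have hm : Measurable fun x => min (W x) N := H.meas_W.min measurable_const
    have hb : ∀ x, |min (W x) N| ≤ N := fun x => by
      rw [abs_of_nonneg (le_min (hW0 x) (Nat.cast_nonneg N))]; exact min_le_right _ _
    have hbi : Integrable (fun ω => min (W (X (n + 1) ω)) N) Pr :=
      (integrable_const (N : ℝ)).mono' (H.measurable_comp hm (n + 1)).aestronglyMeasurable
        (ae_of_all _ fun ω => hb _)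
    rw [← ofReal_integral_eq_lintegral_ofReal hbi
      (ae_of_all _ fun ω => le_min (hW0 _) (Nat.cast_nonneg N))]
    refine ENNReal.ofReal_le_ofReal ?_
    rw [← integral_condExp (ℱ.le n)]
    refine integral_mono_ae integrable_condExp hi ?_
    filter_upwards [H.condExp_eq n _ hm ⟨N, hb⟩] with ω hω
    rw [hω]
    have := H.prob n ω
    have hWM := H.integrable_W n ω
    refine (integral_mono (hWM.mono' hm.aestronglyMeasurable (ae_of_all _ fun x => ?_)) hWM
      fun x => min_le_left _ _).trans (H.drift n ω)
    rw [Real.norm_eq_abs, abs_of_nonneg (le_min (hW0 x) (Nat.cast_nonneg N))]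
    exact min_le_left _ _
  have hlim : Tendsto (fun N : ℕ => ∫⁻ ω, ENNReal.ofReal (min (W (X (n + 1) ω)) N) ∂Pr) atTop
      (𝓝 (∫⁻ ω, ENNReal.ofReal (W (X (n + 1) ω)) ∂Pr)) := by
    refine lintegral_tendsto_of_tendsto_of_monotone (fun N =>
      ((H.measurable_comp H.meas_W (n + 1)).min measurable_const).ennreal_ofReal.aemeasurable)
      (ae_of_all _ fun ω N N' h => ENNReal.ofReal_le_ofReal
        (min_le_min_left _ (by exact_mod_cast h))) (ae_of_all _ fun ω => ?_)
    obtain ⟨N₀, hN₀⟩ := exists_nat_ge (W (X (n + 1) ω))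
    refine tendsto_const_nhds.congr' ?_
    filter_upwards [eventually_ge_atTop N₀] with N hN
    rw [min_eq_left (hN₀.trans (by exact_mod_cast hN))]
  have hle := le_of_tendsto' hlim hbound
  have hint : Integrable (fun ω => W (X (n + 1) ω)) Pr := by
    refine (lintegral_ofReal_ne_top_iff_integrable
      (H.measurable_comp H.meas_W (n + 1)).aestronglyMeasurable (ae_of_all _ fun ω => hW0 _)).1 ?_
    exact ne_top_of_le_ne_top ENNReal.ofReal_ne_top hle
  refine ⟨hint, ?_⟩
  rw [← ofReal_integral_eq_lintegral_ofReal hint (ae_of_all _ fun ω => hW0 _)] at hle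
  exact (ENNReal.ofReal_le_ofReal_iff hD0).1 hle

lemma exists_moment_bound (H : IsDriftedChain Pr ℱ X M W γ c) :
    ∃ B, ∀ n, Integrable (fun ω => W (X n ω)) Pr ∧ ∫ ω, W (X n ω) ∂Pr ≤ B := by
  obtain ⟨C, hC⟩ := H.bdd_c
  have hγ : 0 < 1 - γ := by linarith [H.rate_lt_one]
  -- `C / (1 - γ)` is the fixed point of `t ↦ γ * t + C`, so `B` is preserved by the moment
  -- recursion.
  set B := max (∫ ω, W (X 0 ω) ∂Pr) (C / (1 - γ)) with hB
  have hBC : γ * B + C ≤ B := by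
    have := (div_le_iff₀ hγ).1 (le_max_right (∫ ω, W (X 0 ω) ∂Pr) (C / (1 - γ)))
    rw [← hB] at this
    linarith
  refine ⟨B, fun n => ?_⟩
  induction n with
  | zero => exact ⟨H.initial, le_max_left _ _⟩
  | succ n ih =>
    obtain ⟨h1, h2⟩ := H.integrable_succ ih.1
    refine ⟨h1, h2.trans ?_⟩
    rw [integral_add (ih.1.const_mul γ) (H.integrable_c n), integral_const_mul]
    have := mul_le_mul_of_nonneg_left ih.2 H.nonneg_rate
    linarith [hC n]

/-- The strong law for the one-step prediction errors of functions dominated by `W ^ a`. -/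
lemma ae_tendsto_cesaroAvg_prediction (H : IsDriftedChain Pr ℱ X M W γ c) {a C : ℝ}
    (ha : a ∈ Set.Ioo (0 : ℝ) 1) {h : E → ℝ} (hh : Measurable h)
    (hC0 : 0 ≤ C) (hhC : ∀ x, |h x| ≤ C * W x ^ a) :
    ∀ᵐ ω ∂Pr, Tendsto (cesaroAvg fun k => h (X (k + 1) ω) - ∫ y, h y ∂(M k ω)) atTop (𝓝 0) := by
  obtain ⟨B, hB⟩ := H.exists_moment_bound
  obtain ⟨Cc, hCc⟩ := H.bdd_c
  have hW0 : ∀ x, 0 < W x := fun x => zero_lt_one.trans_le (H.one_le_W x)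
  have hk1 : ∀ k : ℕ, (0 : ℝ) < (k : ℝ) + 1 := fun k => by positivity
  -- Truncation at level `k + 1` balances two needs: second moments of order `(k + 1) ^ a`, summable
  -- against `(k + 1) ^ (-2)`, and remainders of order `(k + 1) ^ (a - 1) * W`, whose averages
  -- vanish.
  set φ : ℕ → E → ℝ := fun k => {x | W x ≤ (k : ℝ) + 1}.indicator h with hφ
  have hφm : ∀ k, Measurable (φ k) := fun k =>
    hh.indicator (measurableSet_le H.meas_W measurable_const)
  have hφb : ∀ k x, |φ k x| ≤ C * ((k : ℝ) + 1) ^ a := fun k x => by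
    by_cases hx : W x ≤ (k : ℝ) + 1
    · simp only [hφ, Set.indicator_of_mem (show x ∈ {x | W x ≤ (k : ℝ) + 1} from hx)]
      exact (hhC x).trans
        (mul_le_mul_of_nonneg_left (Real.rpow_le_rpow (hW0 x).le hx ha.1.le) hC0)
    · simp only [hφ, Set.indicator_of_notMem (show x ∉ {x | W x ≤ (k : ℝ) + 1} from hx), abs_zero]
      have := hk1 k
      positivity
  have hφh : ∀ k x, |φ k x| ≤ |h x| := fun k x => 
    norm_indicator_le_norm_self h x
  have hφW : ∀ k x, |φ k x| ≤ C * W x := fun k x => by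
    refine ((hφh k x).trans (hhC x)).trans (mul_le_mul_of_nonneg_left ?_ hC0)
    simpa using Real.rpow_le_rpow_of_exponent_le (H.one_le_W x) ha.2.le
  -- One factor is bounded by the truncation level and the other by `C * W`, so that only the first
  -- moment of `W` enters.
  have hsq : ∀ k x, φ k x ^ 2 ≤ C ^ 2 * ((k : ℝ) + 1) ^ a * W x := fun k x => by
    rw [← sq_abs, sq]
    refine (mul_le_mul (hφb k x) (hφW k x) (abs_nonneg _)
      (mul_nonneg hC0 (Real.rpow_nonneg (hk1 k).le _))).trans (le_of_eq ?_)
    ring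
  have hdiff : ∀ k x, |h x - φ k x| ≤ C * ((k : ℝ) + 1) ^ (a - 1) * W x := fun k x => by
    by_cases hx : W x ≤ (k : ℝ) + 1
    · simp only [hφ, Set.indicator_of_mem (show x ∈ {x | W x ≤ (k : ℝ) + 1} from hx), sub_self,
        abs_zero]
      have := hk1 k
      have := hW0 x
      positivity
    · simp only [hφ, Set.indicator_of_notMem (show x ∉ {x | W x ≤ (k : ℝ) + 1} from hx), sub_zero]
      refine (hhC x).trans ?_
      rw [mul_assoc]
      exact mul_le_mul_of_nonneg_left
        (rpow_le_mul_of_le (hk1 k) (not_le.1 hx).le ha.2.le) hC0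
  have hsum : Summable fun k : ℕ => (∫ ω, φ k (X (k + 1) ω) ^ 2 ∂Pr) / ((k : ℝ) + 1) ^ 2 := by
    refine Summable.of_nonneg_of_le (fun k => div_nonneg (integral_nonneg fun ω => sq_nonneg _)
      (by positivity)) (fun k => ?_) ((summable_succ_rpow ha.2).mul_left (C ^ 2 * B))
    have h1 : ∫ ω, φ k (X (k + 1) ω) ^ 2 ∂Pr ≤ C ^ 2 * ((k : ℝ) + 1) ^ a * B := by
      refine (integral_mono_of_nonneg (ae_of_all _ fun ω => sq_nonneg _)
        ((hB (k + 1)).1.const_mul _) (ae_of_all _ fun ω => hsq k _)).trans ?_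
      rw [integral_const_mul]
      exact mul_le_mul_of_nonneg_left (hB (k + 1)).2 (by have := hk1 k; positivity)
    refine (div_le_div_of_nonneg_right h1 (by positivity)).trans (le_of_eq ?_)
    have := (hk1 k).ne'
    rw [Real.rpow_sub_one this]
    field_simp
  have hlln := ae_tendsto_cesaroAvg_sub_condExp (Pr := Pr) ℱ (fun k ω => φ k (X (k + 1) ω))
    (fun k => (hφm k).comp (H.adapted (k + 1))) (fun k => ⟨_, fun ω => hφb k _⟩) hsum
  have hcond : ∀ᵐ ω ∂Pr, ∀ k, (Pr[fun ω => φ k (X (k + 1) ω) | ℱ k]) ω = ∫ y, φ k y ∂(M k ω) :=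
    ae_all_iff.2 fun k => H.condExp_eq k (φ k) (hφm k) ⟨_, hφb k⟩
  -- The first summand of `u` controls the truncation error at `X (k + 1)`, the second, through the
  -- drift, that of the conditional expectation.
  have hrem := ae_tendsto_cesaroAvg_rpow_mul (Pr := Pr)
    (u := fun k ω => W (X (k + 1) ω) + (γ * W (X k ω) + c k ω)) (a := a) (B := B + (γ * B + Cc))
    (fun k ω => add_nonneg (hW0 _).le (add_nonneg (mul_nonneg H.nonneg_rate (hW0 _).le)
      (H.nonneg_c k ω)))
    (fun k => (hB (k + 1)).1.add (((hB k).1.const_mul γ).add (H.integrable_c k)))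
    (fun k => by
      have h1 : Integrable (fun ω => γ * W (X k ω) + c k ω) Pr :=
        ((hB k).1.const_mul γ).add (H.integrable_c k)
      rw [integral_add (hB (k + 1)).1 h1, integral_add ((hB k).1.const_mul γ) (H.integrable_c k), integral_const_mul]
      have := mul_le_mul_of_nonneg_left (hB k).2 H.nonneg_rate
      linarith [hCc k, (hB (k + 1)).2]) ha.2
  filter_upwards [hlln, hcond, hrem] with ω h1 h2 h3
  simp only [h2] at h1
  have h4 : Tendsto (cesaroAvg fun k => (h (X (k + 1) ω) - ∫ y, h y ∂(M k ω)) -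
      (φ k (X (k + 1) ω) - ∫ y, φ k y ∂(M k ω))) atTop (𝓝 0) := by
    have h3' := h3.const_mul C
    rw [mul_zero] at h3'
    refine squeeze_zero_norm (fun n => ?_) h3'
    rw [Real.norm_eq_abs, ← cesaroAvg_const_mul]
    refine (abs_cesaroAvg_le _ n).trans (cesaroAvg_mono (fun k => ?_) n)
    have := H.prob k ω
    have hWi := H.integrable_W k ω
    have hhi : Integrable h (M k ω) := (hWi.const_mul C).mono' hh.aestronglyMeasurable
      (ae_of_all _ fun x => (hhC x).trans (mul_le_mul_of_nonneg_left (by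
        simpa using Real.rpow_le_rpow_of_exponent_le (H.one_le_W x) ha.2.le) hC0))
    have hφi : Integrable (φ k) (M k ω) := (hWi.const_mul C).mono' (hφm k).aestronglyMeasurable
      (ae_of_all _ fun x => hφW k x)
    have h5 : |∫ y, h y ∂(M k ω) - ∫ y, φ k y ∂(M k ω)|
        ≤ C * ((k : ℝ) + 1) ^ (a - 1) * (γ * W (X k ω) + c k ω) := by
      rw [← integral_sub hhi hφi]
      refine (abs_integral_le_integral_abs.trans (integral_mono (hhi.sub hφi).abs
        (hWi.const_mul _) (hdiff k))).trans ?_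
      rw [integral_const_mul]
      exact mul_le_mul_of_nonneg_left (H.drift k ω) (by have := hk1 k; positivity)
    have h6 := hdiff k (X (k + 1) ω)
    have h7 : (h (X (k + 1) ω) - ∫ y, h y ∂(M k ω)) - (φ k (X (k + 1) ω) - ∫ y, φ k y ∂(M k ω))
        = (h (X (k + 1) ω) - φ k (X (k + 1) ω))
          - (∫ y, h y ∂(M k ω) - ∫ y, φ k y ∂(M k ω)) := by ring
    rw [h7]
    refine (abs_sub _ _).trans ?_
    linarith
  have h5 := h4.add h1
  rw [add_zero] at h5
  refine h5.congr fun n => ?_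
  rw [← cesaroAvg_add]
  congr 1
  funext k
  ring

/-- Almost surely, the averages of `W ^ a` along the process are bounded. -/
lemma ae_exists_cesaroAvg_le (H : IsDriftedChain Pr ℱ X M W γ c) {a r : ℝ}
    (ha : a ∈ Set.Ioo (0 : ℝ) 1) (hr : r < 1)
    (hd : ∀ᵐ ω ∂Pr, ∃ D, ∀ k, ∫ y, W y ^ a ∂(M k ω) ≤ r * W (X k ω) ^ a + D) :
    ∀ᵐ ω ∂Pr, ∃ B, ∀ n, cesaroAvg (fun k => W (X k ω) ^ a) n ≤ B := by
  have hV0 : ∀ x, 0 ≤ W x ^ a := fun x => Real.rpow_nonneg (zero_le_one.trans (H.one_le_W x)) _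
  filter_upwards [hd, H.ae_tendsto_cesaroAvg_prediction ha (H.meas_W.pow_const a) zero_le_one
    (fun x => by rw [abs_of_nonneg (hV0 x), one_mul])] with ω ⟨D, hD⟩ hlim
  obtain ⟨B₁, hB₁⟩ := hlim.bddAbove_range
  have hr' : 0 < 1 - r := by linarith
  -- Averaging `W(X_{k+1})^a - r W(X_k)^a ≤ error + D` and shifting the index leaves `(1 - r)` times
  -- the average on the left. The `max 0` serves `n = 0`, where the average is `0`.
  refine ⟨max 0 ((B₁ + D + W (X 0 ω) ^ a) / (1 - r)), fun n => ?_⟩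
  rcases Nat.eq_zero_or_pos n with rfl | hn
  · simp [cesaroAvg]
  refine le_max_of_le_right ((le_div_iff₀ hr').2 ?_)
  have h1 := hB₁ ⟨n, rfl⟩
  rw [cesaroAvg_sub, cesaroAvg_shift (fun k => W (X k ω) ^ a)] at h1
  have h2 := cesaroAvg_mono hD n
  rw [cesaroAvg_add, cesaroAvg_const_mul, cesaroAvg_const _ hn.ne'] at h2
  have h3 : -(W (X 0 ω) ^ a) ≤ (1 / (n : ℝ)) * (W (X n ω) ^ a - W (X 0 ω) ^ a) := by
    have hn1 : (1 : ℝ) ≤ n := by exact_mod_cast hn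
    have h4 : 1 / (n : ℝ) ≤ 1 := by rw [div_le_one (by linarith)]; exact hn1
    have h5 : (1 / (n : ℝ)) * W (X 0 ω) ^ a ≤ W (X 0 ω) ^ a := mul_le_of_le_one_left (hV0 _) h4
    have h6 : 0 ≤ (1 / (n : ℝ)) * W (X n ω) ^ a := mul_nonneg (by positivity) (hV0 _)
    linarith
  linarith

end IsDriftedChain

/-! ### Uniform comparison of the adaptive and limiting operators. -/

section Uniform

variable {E : Type*} [MeasurableSpace E]

lemma integrable_min_mul {m : Measure E} {q h : E → ℝ} (hq : Measurable q) (hq0 : ∀ x, 0 ≤ q x)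
    (hh : Integrable h m) {r : ℝ} (hr : 0 ≤ r) : Integrable (fun y => min 1 (r * q y) * h y) m :=
  hh.bdd_mul (c := 1) (measurable_const.min (hq.const_mul r)).aestronglyMeasurable
    (ae_of_all _ fun y => by
      rw [Real.norm_eq_abs, abs_of_nonneg (le_min zero_le_one (mul_nonneg hr (hq0 y)))]
      exact min_le_left _ _)

lemma abs_integral_min_mul_le {m : Measure E} {q h : E → ℝ} (hq : Measurable q)
    (hq0 : ∀ x, 0 ≤ q x) (hh : Integrable h m) {r : ℝ} (hr : 0 ≤ r) :
    |∫ y, min 1 (r * q y) * h y ∂m| ≤ ∫ y, |h y| ∂m := by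
  refine abs_integral_le_integral_abs.trans
    (integral_mono (integrable_min_mul hq hq0 hh hr).abs hh.abs fun y => ?_)
  simp only [abs_mul]
  refine mul_le_of_le_one_left (abs_nonneg _) ?_
  rw [abs_of_nonneg (le_min zero_le_one (mul_nonneg hr (hq0 y)))]
  exact min_le_left _ _

lemma abs_integral_min_mul_sub_le {m : Measure E} {q h : E → ℝ} {Q : ℝ} (hq : Measurable q)
    (hq0 : ∀ x, 0 ≤ q x) (hqQ : ∀ x, q x ≤ Q) (hh : Integrable h m) {r s : ℝ} (hr : 0 ≤ r)
    (hs : 0 ≤ s) :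
    |∫ y, min 1 (r * q y) * h y ∂m - ∫ y, min 1 (s * q y) * h y ∂m|
      ≤ |r - s| * Q * ∫ y, |h y| ∂m := by
  rw [← integral_sub (integrable_min_mul hq hq0 hh hr) (integrable_min_mul hq hq0 hh hs),
    ← integral_const_mul]
  refine abs_integral_le_integral_abs.trans (integral_mono
    ((integrable_min_mul hq hq0 hh hr).sub (integrable_min_mul hq hq0 hh hs)).abs
    (hh.abs.const_mul _) fun y => ?_)
  simp only [← sub_mul, abs_mul]
  refine mul_le_mul_of_nonneg_right ?_ (abs_nonneg _)
  refine (abs_min_sub_min_le_max _ _ _ _).trans ?_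
  rw [sub_self, abs_zero, max_eq_right (abs_nonneg _), ← sub_mul, abs_mul,
    abs_of_nonneg (hq0 y)]
  exact mul_le_mul_of_nonneg_left (hqQ y) (abs_nonneg _)

/-- The functions `y ↦ min 1 (r q(y)) h(y)` are uniformly Lipschitz in `r`, so that convergence of
integrals for rational `r` is locally uniform in `r`. -/
lemma eventually_uniform_min {m : ℕ → Measure E} {m' : Measure E} {q h : E → ℝ} {Q B : ℝ}
    (hq : Measurable q) (hq0 : ∀ x, 0 ≤ q x) (hqQ : ∀ x, q x ≤ Q) (hQ : 0 ≤ Q)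
    (hh : ∀ k, Integrable h (m k)) (hh' : Integrable h m') (hB : ∀ k, ∫ y, |h y| ∂(m k) ≤ B)
    (hB' : ∫ y, |h y| ∂m' ≤ B)
    (hconv : ∀ r : ℚ, 0 ≤ r → Tendsto (fun k => ∫ y, min 1 ((r : ℝ) * q y) * h y ∂(m k)) atTop
      (𝓝 (∫ y, min 1 ((r : ℝ) * q y) * h y ∂m')))
    (R : ℝ) {ε : ℝ} (hε : 0 < ε) :
    ∀ᶠ k in atTop, ∀ r ∈ Set.Icc 0 R,
      |∫ y, min 1 (r * q y) * h y ∂(m k) - ∫ y, min 1 (r * q y) * h y ∂m'| ≤ ε := by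
  have hB0 : 0 ≤ B := (integral_nonneg fun y => abs_nonneg _).trans hB'
  -- A rational mesh `δ` makes every grid point `j * δ` rational. Moving `r` to the grid costs at
  -- most `ε / 4` under either measure, and finitely many grid points cover `[0, R]`.
  obtain ⟨δ, hδ0, hδ⟩ := exists_rat_btwn (show (0 : ℝ) < ε / (4 * (Q * B + 1)) by positivity)
  have hδ0' : (0 : ℚ) < δ := by exact_mod_cast hδ0
  have hδε : (δ : ℝ) * (Q * B) ≤ ε / 4 := by
    rw [lt_div_iff₀ (by positivity)] at hδ
    nlinarith
  obtain ⟨J, hJ⟩ := exists_nat_ge (R / δ)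
  have hfin : ∀ᶠ k in atTop, ∀ j ∈ Finset.range (J + 1),
      |∫ y, min 1 (((j * δ : ℚ) : ℝ) * q y) * h y ∂(m k)
        - ∫ y, min 1 (((j * δ : ℚ) : ℝ) * q y) * h y ∂m'| < ε / 2 := by
    rw [eventually_all_finset]
    intro j _
    have := hconv (j * δ) (by positivity)
    have h2 := (Metric.tendsto_nhds.1 this) (ε / 2) (by positivity)
    simpa only [Real.dist_eq] using h2
  filter_upwards [hfin] with k hk r hr
  set j := ⌊r / δ⌋₊ with hj
  have hjr : (j : ℝ) * δ ≤ r := by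
    have := Nat.floor_le (div_nonneg hr.1 hδ0.le)
    rwa [le_div_iff₀ hδ0] at this
  have hrj : r ≤ (j : ℝ) * δ + δ := by
    have := Nat.lt_floor_add_one (r / δ)
    rw [div_lt_iff₀ hδ0] at this
    linarith
  have hjJ : j ∈ Finset.range (J + 1) := by
    rw [Finset.mem_range, Nat.lt_succ_iff, hj]
    refine Nat.floor_le_of_le ((div_le_div_of_nonneg_right hr.2 hδ0.le).trans hJ)
  have h1 := hk j hjJ
  push_cast at h1
  have hs0 : 0 ≤ (j : ℝ) * δ := by positivity
  have habs : |r - (j : ℝ) * δ| ≤ δ := abs_le.2 ⟨by linarith, by linarith⟩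
  have hlip : ∀ ρ : Measure E, Integrable h ρ → ∫ y, |h y| ∂ρ ≤ B →
      |∫ y, min 1 (r * q y) * h y ∂ρ - ∫ y, min 1 ((j : ℝ) * δ * q y) * h y ∂ρ| ≤ ε / 4 := by
    intro ρ hρ hρB
    refine (abs_integral_min_mul_sub_le hq hq0 hqQ hρ hr.1 hs0).trans (le_trans ?_ hδε)
    rw [mul_assoc]
    refine mul_le_mul habs (mul_le_mul_of_nonneg_left hρB hQ) ?_ hδ0.le
    exact mul_nonneg hQ (integral_nonneg fun y => abs_nonneg _)
  have h2 := abs_le.1 (hlip (m k) (hh k) (hB k))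
  have h3 := abs_le.1 (hlip m' hh' hB')
  have h1' := abs_lt.1 h1
  exact abs_le.2 ⟨by linarith [h1'.1], by linarith [h1'.2]⟩

end Uniform

/-- The form used for uniformity in `x`: the current state enters only through the scalar `r = 1 / π
x ^ (1 - 1 / T)`. -/
lemma accept_eq_min {E : Type*} (π : E → ℝ) (T : ℝ) (x y : E) :
    accept π T x y = min 1 (1 / π x ^ (1 - 1 / T) * π y ^ (1 - 1 / T)) := by
  rw [accept, one_div_mul_eq_div]

section Compare

variable {E : Type*} [TopologicalSpace E] [PolishSpace E] [MeasurableSpace E] [BorelSpace E]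
  {π : E → ℝ} {T υ : ℝ} {P : Kernel E E}

/-- The contribution of `P` cancels. The factor `* 1` puts the rejection term in the same shape as
the acceptance term, so that one uniform estimate serves both. -/
lemma samplerOp_sub (hc : Continuous π) (hp : ∀ x, 0 < π x) (hυ : υ ∈ Set.Ioo (0 : ℝ) 1)
    {θ θ' : Measure E} [IsProbabilityMeasure θ] [IsProbabilityMeasure θ'] {h : E → ℝ} {x : E}
    (hP : Integrable h (P x)) (hθ : Integrable h θ) (hθ' : Integrable h θ') :
    samplerOp π T υ P θ' h x - samplerOp π T υ P θ h x
      = υ * ((∫ y, accept π T x y * h y ∂θ' - ∫ y, accept π T x y * h y ∂θ)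
        - h x * (∫ y, accept π T x y * 1 ∂θ' - ∫ y, accept π T x y * 1 ∂θ)) := by
  rw [samplerOp, samplerOp, (integrable_and_integral_samplerKernel hc hp hυ x hP hθ).2,
    (integrable_and_integral_samplerKernel hc hp hυ x hP hθ').2,
    integral_sub (integrable_const 1) (integrable_accept hc hp x),
    integral_sub (integrable_const 1) (integrable_accept hc hp x)]
  simp
  ring

/-- `P_{θ_k} h - P_θ h` is uniformly negligible with respect to `W ^ a'`, when `h` is dominated by
`W ^ a` with `a < a'`. -/
lemma eventually_samplerOp_sub_le [Nonempty E] (hc : Continuous π) (hp : ∀ x, 0 < π x)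
    (hb : BddAbove (Set.range π)) (hT1 : 1 < T) (hυ : υ ∈ Set.Ioo (0 : ℝ) 1) {W : E → ℝ}
    (hW1 : ∀ x, 1 ≤ W x)
    (hWπ : ∀ M, ∃ R, ∀ x, W x ≤ M → 1 / π x ^ (1 - 1 / T) ≤ R)
    {θk : ℕ → Measure E} {θ : Measure E} [∀ k, IsProbabilityMeasure (θk k)]
    [IsProbabilityMeasure θ] {h : E → ℝ} {a a' C B : ℝ} (ha0 : 0 < a) (haa : a < a')
    (hhC : ∀ x, |h x| ≤ C * W x ^ a) (hP : ∀ x, Integrable h (P x))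
    (hθk : ∀ k, Integrable h (θk k)) (hθ : Integrable h θ) (hB : ∀ k, ∫ y, |h y| ∂(θk k) ≤ B)
    (hB' : ∫ y, |h y| ∂θ ≤ B)
    (hconv : ∀ r : ℚ, 0 ≤ r → Tendsto
      (fun k => ∫ y, min 1 ((r : ℝ) * π y ^ (1 - 1 / T)) * h y ∂(θk k)) atTop
      (𝓝 (∫ y, min 1 ((r : ℝ) * π y ^ (1 - 1 / T)) * h y ∂θ)))
    (hconv1 : ∀ r : ℚ, 0 ≤ r → Tendsto
      (fun k => ∫ y, min 1 ((r : ℝ) * π y ^ (1 - 1 / T)) * 1 ∂(θk k)) atTop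
      (𝓝 (∫ y, min 1 ((r : ℝ) * π y ^ (1 - 1 / T)) * 1 ∂θ)))
    {ε : ℝ} (hε : 0 < ε) :
    ∀ᶠ k in atTop, ∀ x,
      |samplerOp π T υ P (θk k) h x - samplerOp π T υ P θ h x| ≤ ε * W x ^ a' := by
  have hC0 := nonneg_of_abs_le_rpow hW1 hhC
  have hB0 : 0 ≤ B := (integral_nonneg fun y => abs_nonneg _).trans hB'
  have hW0 : ∀ x, 0 < W x := fun x => zero_lt_one.trans_le (hW1 x)
  set q : E → ℝ := fun x => π x ^ (1 - 1 / T) with hq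
  have hqm : Measurable q := hc.measurable.pow_const _
  have hqp : ∀ x, 0 < q x := fun x => Real.rpow_pos_of_pos (hp x) _
  have hq0 : ∀ x, 0 ≤ q x := fun x => (hqp x).le
  have hqQ : ∀ x, q x ≤ supNorm π ^ (1 - 1 / T) := rpow_le_supNorm_rpow hp hb hT1
  have hQ : 0 ≤ supNorm π ^ (1 - 1 / T) := Real.rpow_nonneg (supNorm_pos hp hb).le _
  have h1i : ∀ ρ : Measure E, IsProbabilityMeasure ρ → Integrable (fun _ : E => (1 : ℝ)) ρ :=
    fun ρ _ => integrable_const 1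
  have h1B : ∀ ρ : Measure E, IsProbabilityMeasure ρ → ∫ _, |(1 : ℝ)| ∂ρ ≤ 1 :=
    fun ρ _ => by simp
  have hdecomp : ∀ k x, |samplerOp π T υ P (θk k) h x - samplerOp π T υ P θ h x|
      ≤ |∫ y, min 1 (1 / q x * q y) * h y ∂(θk k) - ∫ y, min 1 (1 / q x * q y) * h y ∂θ|
        + C * W x ^ a *
        |∫ y, min 1 (1 / q x * q y) * 1 ∂(θk k) - ∫ y, min 1 (1 / q x * q y) * 1 ∂θ| := by
    intro k x
    rw [samplerOp_sub hc hp hυ (hP x) hθ (hθk k)]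
    simp only [accept_eq_min]
    rw [abs_mul, abs_of_nonneg hυ.1.le]
    refine (mul_le_of_le_one_left (abs_nonneg _) hυ.2.le).trans ((abs_sub _ _).trans ?_)
    rw [abs_mul]
    exact add_le_add le_rfl (mul_le_mul_of_nonneg_right (hhC x) (abs_nonneg _))
  have hlim : Tendsto (fun M : ℝ => (2 * B + 2 * C) * M ^ (a - a')) atTop (𝓝 0) := by
    have h := tendsto_rpow_neg_atTop (y := a' - a) (by linarith)
    rw [neg_sub] at h
    simpa using h.const_mul (2 * B + 2 * C)
  obtain ⟨M, hMε, hM1⟩ := ((hlim.eventually (gt_mem_nhds hε)).and (eventually_ge_atTop 1)).exists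
  obtain ⟨R, hR⟩ := hWπ M
  have hε' : 0 < ε / (1 + C) := by positivity
  filter_upwards [eventually_uniform_min hqm hq0 hqQ hQ hθk hθ hB hB' hconv R hε',
    eventually_uniform_min hqm hq0 hqQ hQ (fun k => h1i (θk k) inferInstance)
      (h1i θ inferInstance) (fun k => h1B (θk k) inferInstance) (h1B θ inferInstance)
      hconv1 R hε'] with k hk hk1 x
  refine (hdecomp k x).trans ?_
  have hr0 : 0 ≤ 1 / q x := (one_div_pos.2 (hqp x)).le
  have hWa1 : 1 ≤ W x ^ a := Real.one_le_rpow (hW1 x) ha0.le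
  -- For `W x ≤ M` the parameter `r` stays in `[0, R]` and the uniform convergence applies; beyond
  -- `M` a crude bound of order `W ^ a` is at most `ε * W ^ a'` by the choice of `M`.
  rcases le_total (W x) M with hx | hx
  · have hr : 1 / q x ∈ Set.Icc 0 R := ⟨hr0, hR x hx⟩
    have h1 := hk _ hr
    have h2 := mul_le_mul_of_nonneg_left (hk1 _ hr) (by positivity : 0 ≤ C * W x ^ a)
    have h3 : W x ^ a ≤ W x ^ a' := Real.rpow_le_rpow_of_exponent_le (hW1 x) haa.le
    have h4 : ε / (1 + C) + C * W x ^ a * (ε / (1 + C)) ≤ ε * W x ^ a := by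
      have h5 : ε / (1 + C) * (1 + C) = ε := div_mul_cancel₀ _ (by positivity)
      have h6 : ε / (1 + C) * 1 ≤ ε / (1 + C) * W x ^ a := mul_le_mul_of_nonneg_left hWa1 hε'.le
      calc _ ≤ ε / (1 + C) * (1 + C) * W x ^ a := by linarith
        _ = _ := by rw [h5]
    have h5 := mul_le_mul_of_nonneg_left h3 hε.le
    linarith
  · have h1 : |∫ y, min 1 (1 / q x * q y) * h y ∂(θk k) - ∫ y, min 1 (1 / q x * q y) * h y ∂θ|
        ≤ 2 * B := by
      refine (abs_sub _ _).trans ?_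
      linarith [(abs_integral_min_mul_le hqm hq0 (hθk k) hr0).trans (hB k),
        (abs_integral_min_mul_le hqm hq0 hθ hr0).trans hB']
    have h2 : |∫ y, min 1 (1 / q x * q y) * 1 ∂(θk k) - ∫ y, min 1 (1 / q x * q y) * 1 ∂θ|
        ≤ 2 := by
      refine (abs_sub _ _).trans ?_
      linarith [(abs_integral_min_mul_le hqm hq0 (h1i (θk k) inferInstance) hr0).trans
        (h1B (θk k) inferInstance), (abs_integral_min_mul_le hqm hq0 (h1i θ inferInstance)
        hr0).trans (h1B θ inferInstance)]
    have h3 := mul_le_mul_of_nonneg_left h2 (by positivity : 0 ≤ C * W x ^ a)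
    have h4 : W x ^ a ≤ M ^ (a - a') * W x ^ a' := by
      have : W x ^ a = W x ^ (a - a') * W x ^ a' := by
        rw [← Real.rpow_add (hW0 x)]; congr 1; ring
      rw [this]
      exact mul_le_mul_of_nonneg_right
        (Real.rpow_le_rpow_of_nonpos (by linarith) hx (by linarith))
        (Real.rpow_nonneg (hW0 x).le _)
    have h5 := mul_le_mul_of_nonneg_left h4 (by positivity : 0 ≤ 2 * B + 2 * C)
    have h6 := mul_le_mul_of_nonneg_right hMε.le (Real.rpow_nonneg (hW0 x).le a')
    have h7 : 2 * B ≤ 2 * B * W x ^ a := le_mul_of_one_le_right (by positivity) hWa1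
    linarith

end Compare

/-! ### Empirical measures and sublinear growth of powers. -/

section Empirical

variable {E Ω : Type*} [MeasurableSpace E] (Y : ℕ → Ω → E) (n : ℕ) (ω : Ω)

instance isProbabilityMeasure_empiricalMeasure :
    IsProbabilityMeasure (empiricalMeasure Y n ω) := by
  constructor
  simp only [empiricalMeasure, Measure.smul_apply, Measure.finsetSum_apply, measure_univ,
    Finset.sum_const, Finset.card_range, smul_eq_mul, nsmul_eq_mul, mul_one]
  push_cast
  exact ENNReal.inv_mul_cancel (by simp) (by finiteness)

variable [MeasurableSingletonClass E]

lemma integrable_empiricalMeasure (f : E → ℝ) : Integrable f (empiricalMeasure Y n ω) := by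
  refine Integrable.smul_measure ?_ (by simp)
  exact integrable_finsetSum_measure.2 fun k _ => integrable_dirac (by simp)

lemma integral_empiricalMeasure (f : E → ℝ) :
    ∫ x, f x ∂(empiricalMeasure Y n ω) = ((n : ℝ) + 1)⁻¹ * ∑ k ∈ Finset.range (n + 1), f (Y k ω) := by
  rw [empiricalMeasure, integral_smul_measure,
    integral_finsetSum_measure fun k _ => integrable_dirac (by simp)]
  simp only [integral_dirac, smul_eq_mul, ENNReal.toReal_inv]
  congr 2

end Empirical

/-- Powers `u n ^ s`, `s < 1`, of a nonnegative sequence with bounded averages are `o(n)`. -/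
lemma tendsto_rpow_div_of_cesaroAvg_le {u : ℕ → ℝ} {B s : ℝ} (hu : ∀ k, 0 ≤ u k)
    (hB : ∀ n, cesaroAvg u n ≤ B) (hs0 : 0 ≤ s) (hs : s < 1) :
    Tendsto (fun n : ℕ => (1 / (n : ℝ)) * u n ^ s) atTop (𝓝 0) := by
  have hB0 : 0 ≤ B := (cesaroAvg_nonneg hu 0).trans (hB 0)
  have hlim : Tendsto (fun n : ℕ => (2 * B) ^ s * (n : ℝ) ^ (s - 1)) atTop (𝓝 0) := by
    have h := (tendsto_rpow_neg_atTop (y := 1 - s) (by linarith)).comp tendsto_natCast_atTop_atTop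
    rw [neg_sub] at h
    simpa using h.const_mul ((2 * B) ^ s)
  refine squeeze_zero' (.of_forall fun n => mul_nonneg (by positivity)
    (Real.rpow_nonneg (hu n) _)) ?_ hlim
  filter_upwards [eventually_ge_atTop 1] with n hn
  have hn1 : (1 : ℝ) ≤ n := by exact_mod_cast hn
  have hn0 : (0 : ℝ) < n := by linarith
  -- A single term is at most the sum of the first `n + 1`, and `n + 1 ≤ 2 * n`.
  have h1 : u n ≤ 2 * B * n := by
    have h2 := hB (n + 1)
    rw [cesaroAvg, one_div, inv_mul_le_iff₀ (by positivity), Finset.sum_range_succ] at h2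
    have h3 : 0 ≤ ∑ k ∈ Finset.range n, u k := Finset.sum_nonneg fun k _ => hu k
    push_cast at h2
    nlinarith
  have h2 := Real.rpow_le_rpow (hu n) h1 hs0
  rw [Real.mul_rpow (by positivity) hn0.le] at h2
  refine (mul_le_mul_of_nonneg_left h2 (by positivity)).trans (le_of_eq ?_)
  rw [Real.rpow_sub_one hn0.ne']
  ring

/-! ### The strong law for continuous functions. -/

/-- The standing assumptions on the target and on the kernel `P`, with a real-valued drift
condition. -/
structure IsTemperingModel {E : Type*} [TopologicalSpace E] [MeasurableSpace E] (μ : Measure E)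
    (π : E → ℝ) (T υ : ℝ) (P : Kernel E E) (τ lam b : ℝ) : Prop where
  one_lt_T : 1 < T
  mem_υ : υ ∈ Set.Ioo (0 : ℝ) 1
  cont : Continuous π
  pos : ∀ x, 0 < π x
  bdd : BddAbove (Set.range π)
  prob : ∫⁻ x, ENNReal.ofReal (π x) ∂μ = 1
  temp : Integrable (fun x => π x ^ (1 / T)) μ
  markov : IsMarkovKernel P
  feller : IsFeller P
  inv : P.Invariant (targetMeasure μ π)
  τ_pos : 0 < τ
  mem_lam : lam ∈ Set.Ioo (0 : ℝ) 1
  b_nonneg : 0 ≤ b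
  integrable_P : ∀ x, Integrable (driftW π τ) (P x)
  drift : ∀ x, ∫ y, driftW π τ y ∂(P x) ≤ lam * driftW π τ x + b
  small : ∀ p ∈ Set.Ioo 0 (supNorm π), IsOneSmall P {x | p ≤ π x}
  integrable_tempered : Integrable (driftW π τ) (temperedMeasure μ π T)

namespace IsTemperingModel

variable {E : Type*} [TopologicalSpace E] [MeasurableSpace E]
  {μ : Measure E} {π : E → ℝ} {T υ : ℝ} {P : Kernel E E} {τ lam b : ℝ}

lemma measure_ne_zero (H : IsTemperingModel μ π T υ P τ lam b) : μ ≠ 0 := by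
  rintro rfl
  have := H.prob
  simp at this

lemma nonempty (H : IsTemperingModel μ π T υ P τ lam b) : Nonempty E := by
  by_contra h
  rw [not_nonempty_iff] at h
  exact H.measure_ne_zero (Measure.eq_zero_of_isEmpty μ)

lemma one_le_W (H : IsTemperingModel μ π T υ P τ lam b) (x : E) : 1 ≤ driftW π τ x :=
  one_le_driftW H.pos H.bdd H.τ_pos x

lemma continuous_W (H : IsTemperingModel μ π T υ P τ lam b) : Continuous (driftW π τ) :=
  continuous_driftW H.cont H.pos H.bdd τ

lemma isProbabilityMeasure_tempered (H : IsTemperingModel μ π T υ P τ lam b) :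
    IsProbabilityMeasure (temperedMeasure μ π T) :=
  isProbabilityMeasure_temperedMeasure H.pos H.measure_ne_zero H.temp

lemma exists_inv_rpow_le (H : IsTemperingModel μ π T υ P τ lam b) (M : ℝ) :
    ∃ R, ∀ x, driftW π τ x ≤ M → 1 / π x ^ (1 - 1 / T) ≤ R := by
  have := H.nonempty
  refine ⟨1 / (supNorm π * M ^ (-(1 / τ))) ^ (1 - 1 / T), fun x hx => ?_⟩
  have hM : 0 < M := zero_lt_one.trans_le ((H.one_le_W x).trans hx)
  have hp : 0 < supNorm π * M ^ (-(1 / τ)) :=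
    mul_pos (supNorm_pos H.pos H.bdd) (Real.rpow_pos_of_pos hM _)
  refine one_div_le_one_div_of_le (Real.rpow_pos_of_pos hp _)
    (Real.rpow_le_rpow hp.le (le_of_driftW_le H.pos H.bdd H.τ_pos hx) ?_)
  exact sub_nonneg.2 ((div_le_one (by linarith [H.one_lt_T])).2 H.one_lt_T.le)

variable [BorelSpace E]

lemma integrable_target_of_class (H : IsTemperingModel μ π T υ P τ lam b) {a : ℝ}
    (ha : a ∈ Set.Ioo (0 : ℝ) 1) {f : E → ℝ} (hf : Continuous f) {C : ℝ}
    (hfC : ∀ x, |f x| ≤ C * driftW π τ x ^ a) :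
    Integrable f (temperedMeasure μ π T) ∧ Integrable f (targetMeasure μ π) := by
  have h := integrable_of_abs_le_rpow H.continuous_W.measurable H.one_le_W H.integrable_tempered
    ⟨ha.1, ha.2.le⟩ hf.measurable hfC
  exact ⟨h, integrable_targetMeasure_of_tempered H.cont H.pos H.bdd H.one_lt_T
    H.measure_ne_zero H.temp h⟩

variable [PolishSpace E]

/-- The limiting transition operator preserves the class of continuous functions dominated by
multiples of `W ^ a`. -/
lemma samplerOp_class (H : IsTemperingModel μ π T υ P τ lam b) {a : ℝ}
    (ha : a ∈ Set.Ioo (0 : ℝ) 1) {f : E → ℝ} (hf : Continuous f) {C : ℝ}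
    (hfC : ∀ x, |f x| ≤ C * driftW π τ x ^ a) :
    Continuous (samplerOp π T υ P (temperedMeasure μ π T) f) ∧
      ∃ C', ∀ x, |samplerOp π T υ P (temperedMeasure μ π T) f x| ≤ C' * driftW π τ x ^ a := by
  have := H.nonempty
  have := H.markov
  have := H.isProbabilityMeasure_tempered
  exact ⟨continuous_samplerOp H.cont H.pos H.mem_υ H.feller H.continuous_W H.one_le_W ha
    H.mem_lam.1.le H.b_nonneg H.integrable_P H.drift H.integrable_tempered hf hfC,
    _, abs_samplerOp_le H.cont H.pos H.mem_υ H.continuous_W.measurable H.one_le_W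
      ⟨ha.1, ha.2.le⟩ H.mem_lam.1.le H.b_nonneg H.integrable_P H.drift H.integrable_tempered
      hf.measurable hfC⟩

lemma iterate_samplerOp_class (H : IsTemperingModel μ π T υ P τ lam b) {a : ℝ}
    (ha : a ∈ Set.Ioo (0 : ℝ) 1) {f : E → ℝ} (hf : Continuous f) {C : ℝ}
    (hfC : ∀ x, |f x| ≤ C * driftW π τ x ^ a) (n : ℕ) :
    Continuous ((samplerOp π T υ P (temperedMeasure μ π T))^[n] f) ∧ ∃ C', ∀ x,
      |((samplerOp π T υ P (temperedMeasure μ π T))^[n] f) x| ≤ C' * driftW π τ x ^ a := by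
  induction n with
  | zero => exact ⟨hf, C, hfC⟩
  | succ n ih =>
    obtain ⟨h1, C', h2⟩ := ih
    rw [Function.iterate_succ_apply']
    exact H.samplerOp_class ha h1 h2

/-- Geometric convergence of the iterates of the limiting transition operator. -/
lemma exists_geometric_bound (H : IsTemperingModel μ π T υ P τ lam b) {a : ℝ}
    (ha : a ∈ Set.Ioo (0 : ℝ) 1) {f : E → ℝ} (hf : Continuous f) {C : ℝ}
    (hfC : ∀ x, |f x| ≤ C * driftW π τ x ^ a) :
    ∃ α B : ℝ, 0 ≤ α ∧ α < 1 ∧ 0 ≤ B ∧ ∀ n x,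
      |((samplerOp π T υ P (temperedMeasure μ π T))^[n] f) x - ∫ x, f x ∂(targetMeasure μ π)|
        ≤ B * α ^ n * driftW π τ x ^ a := by
  have := H.nonempty
  have := H.markov
  have := H.isProbabilityMeasure_tempered
  have := isProbabilityMeasure_targetMeasure H.prob
  have ha' : a ∈ Set.Ioc (0 : ℝ) 1 := ⟨ha.1, ha.2.le⟩
  have hWm := H.continuous_W.measurable
  have := fun x => isProbabilityMeasure_samplerKernel (P := P) (θ := temperedMeasure μ π T)
    (T := T) H.cont H.pos H.mem_υ x
  have hW0 : ∀ x, 0 ≤ driftW π τ x := fun x => zero_le_one.trans (H.one_le_W x)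
  have hV : Continuous fun x => driftW π τ x ^ a :=
    H.continuous_W.rpow_const fun x => Or.inr ha.1.le
  refine InteractingTempering.exists_geometric_bound
    (samplerKernel π T υ P (temperedMeasure μ π T))
    (fun x => Real.one_le_rpow (H.one_le_W x) ha.1.le)
    (fun x => rpow_integrable_of_one_le hWm H.one_le_W
      (integrable_and_integral_samplerKernel H.cont H.pos H.mem_υ x (H.integrable_P x)
        H.integrable_tempered).1 ha')
    (γ := (1 - υ) * lam ^ a + υ)
    (K := b ^ a + ∫ y, driftW π τ y ^ a ∂(temperedMeasure μ π T)) ?_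
    (contraction_factor_lt_one H.mem_υ ha.1 H.mem_lam) ?_
    (fun x => integral_rpow_samplerKernel_le H.cont H.pos H.mem_υ hWm H.one_le_W ha'
      H.mem_lam.1.le H.b_nonneg H.integrable_P H.drift H.integrable_tempered x)
    (samplerKernel_small H.pos H.bdd H.mem_υ H.τ_pos ha.1 H.small)
    (H.integrable_target_of_class ha hV (C := 1)
      (fun x => by rw [abs_of_nonneg (Real.rpow_nonneg (hW0 x) _), one_mul])).2
    hfC _ (fun φ x => rfl) (fun n => (H.iterate_samplerOp_class ha hf hfC n).1.measurable) ?_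
  · have := Real.rpow_nonneg H.mem_lam.1.le a
    have h1 : 0 ≤ 1 - υ := by linarith [H.mem_υ.2]
    have h2 := H.mem_υ.1
    positivity
  · exact add_nonneg (Real.rpow_nonneg H.b_nonneg _)
      (integral_nonneg fun y => Real.rpow_nonneg (hW0 y) _)
  · intro n
    induction n with
    | zero => rfl
    | succ n ih =>
      obtain ⟨h1, C', h2⟩ := H.iterate_samplerOp_class ha hf hfC n
      obtain ⟨h3, C'', h4⟩ := H.samplerOp_class ha h1 h2
      rw [Function.iterate_succ_apply', ← ih]
      exact integral_samplerOp_tempered H.cont H.pos H.bdd H.one_lt_T H.measure_ne_zero H.temp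
        H.mem_υ H.inv (fun x => integrable_of_abs_le_rpow hWm H.one_le_W (H.integrable_P x) ha'
          h1.measurable h2) (H.integrable_target_of_class ha h1 h2).1
        (H.integrable_target_of_class ha h3 h4).2

section SamplePaths

variable {Ω : Type*} [MeasurableSpace Ω] {Pr : Measure Ω} [IsProbabilityMeasure Pr]
  {ℱ : Filtration ℕ (inferInstance : MeasurableSpace Ω)} {X Y : ℕ → Ω → E}

/-- This is the kernel drift at exponent `1`. The additive term `b + θ_n(W)` is random, but the
moment bound on `Y` controls its mean uniformly in `n`. -/
lemma isDriftedChain (H : IsTemperingModel μ π T υ P τ lam b)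
    (hXY : IsSampler Pr ℱ π T υ P X Y)
    (hYi : ∀ k, Integrable (fun ω => driftW π τ (Y k ω)) Pr) {C : ℝ}
    (hYC : ∀ k, ∫ ω, driftW π τ (Y k ω) ∂Pr ≤ C)
    (hX0 : Integrable (fun ω => driftW π τ (X 0 ω)) Pr) :
    IsDriftedChain Pr ℱ X (fun n ω => samplerKernel π T υ P (empiricalMeasure Y n ω) (X n ω))
      (driftW π τ) ((1 - υ) * lam + υ)
      (fun n ω => b + ∫ y, driftW π τ y ∂(empiricalMeasure Y n ω)) := by
  have := H.markov
  have hW0 : ∀ x, 0 ≤ driftW π τ x := fun x => zero_le_one.trans (H.one_le_W x)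
  have hci : ∀ n, Integrable (fun ω => b + ∫ y, driftW π τ y ∂(empiricalMeasure Y n ω)) Pr := by
    intro n
    simp only [integral_empiricalMeasure]
    exact (integrable_const b).add ((integrable_finsetSum _ fun k _ => hYi k).const_mul _)
  have h1υ : 0 < 1 - υ := by linarith [H.mem_υ.2]
  refine ⟨hXY.adapted_X, fun n ω => isProbabilityMeasure_samplerKernel H.cont H.pos H.mem_υ _,
    hXY.condExp_eq, H.continuous_W.measurable, H.one_le_W, fun n ω =>
    (integrable_and_integral_samplerKernel H.cont H.pos H.mem_υ _ (H.integrable_P _)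
      (integrable_empiricalMeasure Y n ω _)).1, fun n ω => ?_, ?_, ?_, ?_, hci, ?_, hX0⟩
  · simpa only [Real.rpow_one] using integral_rpow_samplerKernel_le (T := T) (a := 1) H.cont H.pos
      H.mem_υ H.continuous_W.measurable H.one_le_W ⟨one_pos, le_rfl⟩ H.mem_lam.1.le H.b_nonneg
      H.integrable_P H.drift (integrable_empiricalMeasure Y n ω _) (X n ω)
  · exact add_nonneg (mul_nonneg h1υ.le H.mem_lam.1.le) H.mem_υ.1.le
  · simpa using contraction_factor_lt_one H.mem_υ one_pos H.mem_lam
  · exact fun n ω => add_nonneg H.b_nonneg (integral_nonneg hW0)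
  · refine ⟨b + C, fun n => ?_⟩
    simp only [integral_empiricalMeasure]
    rw [integral_add (integrable_const b)
      ((integrable_finsetSum _ fun k _ => hYi k).const_mul _), integral_const_mul,
      integral_finsetSum _ fun k _ => hYi k]
    have h1 : ∑ k ∈ Finset.range (n + 1), ∫ ω, driftW π τ (Y k ω) ∂Pr ≤ ((n : ℝ) + 1) * C := by
      refine (Finset.sum_le_sum fun k _ => hYC k).trans (le_of_eq ?_)
      simp
    have h2 : ((n : ℝ) + 1)⁻¹ * ∑ k ∈ Finset.range (n + 1), ∫ ω, driftW π τ (Y k ω) ∂Pr ≤ C := by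
      rwa [inv_mul_le_iff₀ (by positivity)]
    simpa using h2

/-- Along the sampler, the averages of `h - P_⋆ h` vanish almost surely. -/
lemma ae_tendsto_cesaroAvg_sub_samplerOp (H : IsTemperingModel μ π T υ P τ lam b)
    {γ : ℝ} {c : ℕ → Ω → ℝ}
    (HD : IsDriftedChain Pr ℱ X
      (fun n ω => samplerKernel π T υ P (empiricalMeasure Y n ω) (X n ω)) (driftW π τ) γ c)
    (hY : ∀ f : E → ℝ, Continuous f → MemL (driftW π τ) f →
      ∀ᵐ ω ∂Pr, Tendsto (fun n => ∫ x, f x ∂(empiricalMeasure Y n ω)) atTop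
        (𝓝 (∫ x, f x ∂(temperedMeasure μ π T))))
    (hbdd : ∀ a ∈ Set.Ioo (0 : ℝ) 1,
      ∀ᵐ ω ∂Pr, ∃ B, ∀ n, cesaroAvg (fun k => driftW π τ (X k ω) ^ a) n ≤ B)
    {a : ℝ} (ha : a ∈ Set.Ioo (0 : ℝ) 1) {h : E → ℝ} (hh : Continuous h) {C : ℝ}
    (hhC : ∀ x, |h x| ≤ C * driftW π τ x ^ a) :
    ∀ᵐ ω ∂Pr, Tendsto (cesaroAvg fun k =>
      h (X k ω) - samplerOp π T υ P (temperedMeasure μ π T) h (X k ω)) atTop (𝓝 0) := by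
  have := H.nonempty
  have := H.markov
  have := H.isProbabilityMeasure_tempered
  have hW0 : ∀ x, 0 < driftW π τ x := fun x => zero_lt_one.trans_le (H.one_le_W x)
  have hC0 := nonneg_of_abs_le_rpow H.one_le_W hhC
  -- The room between `a` and `a'` absorbs both the adaptation error outside `{W ≤ M}` and the
  -- boundary term, while `a' < 1` keeps the averages of `W ^ a'` bounded.
  obtain ⟨a', haa, ha'1⟩ := exists_between ha.2
  have ha'0 : 0 < a' := ha.1.trans haa
  have hhW : ∀ x, |h x| ≤ C * driftW π τ x := fun x => by
    refine (hhC x).trans (mul_le_mul_of_nonneg_left ?_ hC0)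
    simpa using Real.rpow_le_rpow_of_exponent_le (H.one_le_W x) ha.2.le
  have hmem : ∀ r : ℚ, 0 ≤ r → ∀ g : E → ℝ, ∀ D : ℝ, (∀ x, |g x| ≤ D * driftW π τ x) →
      MemL (driftW π τ) fun y => min 1 ((r : ℝ) * π y ^ (1 - 1 / T)) * g y := by
    intro r hr g D hg
    have hr' : (0 : ℝ) ≤ r := by exact_mod_cast hr
    refine ⟨D, fun x => (div_le_iff₀ (hW0 x)).2 (le_trans ?_ (hg x))⟩
    rw [abs_mul, abs_of_nonneg (le_min zero_le_one
      (mul_nonneg hr' (Real.rpow_nonneg (H.pos x).le _)))]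
    exact mul_le_of_le_one_left (abs_nonneg _) (min_le_left _ _)
  have hcont : ∀ r : ℚ, Continuous fun y => min 1 ((r : ℝ) * π y ^ (1 - 1 / T)) := fun r =>
    continuous_const.min (continuous_const.mul (H.cont.rpow_const fun x => Or.inl (H.pos x).ne'))
  -- The null set in the assumption on `Y` depends on the test function; rational `r` leave only
  -- countably many of them.
  have hconv : ∀ᵐ ω ∂Pr, ∀ r : ℚ, 0 ≤ r → Tendsto (fun k =>
      ∫ y, min 1 ((r : ℝ) * π y ^ (1 - 1 / T)) * h y ∂(empiricalMeasure Y k ω)) atTop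
      (𝓝 (∫ y, min 1 ((r : ℝ) * π y ^ (1 - 1 / T)) * h y ∂(temperedMeasure μ π T))) := by
    simp only [ae_all_iff]
    exact fun r hr => hY _ ((hcont r).mul hh) (hmem r hr h C hhW)
  have hconv1 : ∀ᵐ ω ∂Pr, ∀ r : ℚ, 0 ≤ r → Tendsto (fun k =>
      ∫ y, min 1 ((r : ℝ) * π y ^ (1 - 1 / T)) * 1 ∂(empiricalMeasure Y k ω)) atTop
      (𝓝 (∫ y, min 1 ((r : ℝ) * π y ^ (1 - 1 / T)) * 1 ∂(temperedMeasure μ π T))) := by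
    simp only [ae_all_iff]
    exact fun r hr => hY _ ((hcont r).mul continuous_const) (hmem r hr (fun _ => 1) 1 fun x => by
      simpa using H.one_le_W x)
  have habs : ∀ᵐ ω ∂Pr, Tendsto (fun k => ∫ y, |h y| ∂(empiricalMeasure Y k ω)) atTop
      (𝓝 (∫ y, |h y| ∂(temperedMeasure μ π T))) :=
    hY _ hh.abs ⟨C, fun x => (div_le_iff₀ (hW0 x)).2 (by rw [abs_abs]; exact hhW x)⟩
  filter_upwards [hconv, hconv1, habs, hbdd a' ⟨ha'0, ha'1⟩,
    HD.ae_tendsto_cesaroAvg_prediction ha hh.measurable hC0 hhC] with ω h1 h2 h3 ⟨B', hB'⟩ h5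
  obtain ⟨B, hB⟩ := h3.bddAbove_range
  have hV0 : ∀ k, 0 ≤ driftW π τ (X k ω) ^ a' := fun k => Real.rpow_nonneg (hW0 _).le _
  have hcmp : Tendsto (cesaroAvg fun k =>
      samplerOp π T υ P (empiricalMeasure Y k ω) h (X k ω)
        - samplerOp π T υ P (temperedMeasure μ π T) h (X k ω)) atTop (𝓝 0) := by
    refine tendsto_cesaroAvg_of_negligible hV0 hB' fun ε hε => ?_
    exact (eventually_samplerOp_sub_le H.cont H.pos H.bdd H.one_lt_T H.mem_υ H.one_le_W
      H.exists_inv_rpow_le ha.1 haa hhC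
      (fun x => integrable_of_abs_le_rpow H.continuous_W.measurable H.one_le_W (H.integrable_P x)
        ⟨ha.1, ha.2.le⟩ hh.measurable hhC)
      (fun k => integrable_empiricalMeasure Y k ω h) (H.integrable_target_of_class ha hh hhC).1
      (fun k => hB ⟨k, rfl⟩) (le_of_tendsto' h3 fun k => hB ⟨k, rfl⟩) h1 h2 hε).mono fun k hk => hk (X k ω)
  have hbdry : Tendsto (fun n : ℕ => (1 / (n : ℝ)) * (h (X n ω) - h (X 0 ω))) atTop (𝓝 0) := by
    have h6 : Tendsto (fun n : ℕ => (1 / (n : ℝ)) * h (X n ω)) atTop (𝓝 0) := by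
      have h7 := (tendsto_rpow_div_of_cesaroAvg_le (s := a / a') hV0 hB'
        (div_nonneg ha.1.le ha'0.le) ((div_lt_one ha'0).2 haa)).const_mul C
      rw [mul_zero] at h7
      refine squeeze_zero_norm (fun n => ?_) h7
      rw [← Real.rpow_mul (hW0 _).le, mul_div_cancel₀ _ ha'0.ne', Real.norm_eq_abs, abs_mul,
        abs_of_nonneg (by positivity : (0 : ℝ) ≤ 1 / (n : ℝ)), mul_left_comm]
      exact mul_le_mul_of_nonneg_left (hhC _) (by positivity)
    have h7 := h6.sub (tendsto_one_div_atTop_nhds_zero_nat.mul_const (h (X 0 ω)))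
    rw [zero_mul, sub_zero] at h7
    exact h7.congr fun n => by ring
  have h6 := (h5.add hcmp).sub hbdry
  rw [add_zero, sub_zero] at h6
  refine h6.congr fun n => ?_
  rw [cesaroAvg_sub, cesaroAvg_sub, cesaroAvg_sub, cesaroAvg_shift (fun k => h (X k ω))]
  simp only [samplerOp]
  ring

/-- The strong law for continuous functions dominated by `W ^ a`. -/
lemma ae_tendsto_cesaroAvg (H : IsTemperingModel μ π T υ P τ lam b)
    {γ : ℝ} {c : ℕ → Ω → ℝ}
    (HD : IsDriftedChain Pr ℱ X
      (fun n ω => samplerKernel π T υ P (empiricalMeasure Y n ω) (X n ω)) (driftW π τ) γ c)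
    (hY : ∀ f : E → ℝ, Continuous f → MemL (driftW π τ) f →
      ∀ᵐ ω ∂Pr, Tendsto (fun n => ∫ x, f x ∂(empiricalMeasure Y n ω)) atTop
        (𝓝 (∫ x, f x ∂(temperedMeasure μ π T))))
    {a : ℝ} (ha : a ∈ Set.Ioo (0 : ℝ) 1) {f : E → ℝ} (hf : Continuous f) {C : ℝ}
    (hfC : ∀ x, |f x| ≤ C * driftW π τ x ^ a) :
    ∀ᵐ ω ∂Pr, Tendsto (cesaroAvg fun k => f (X k ω)) atTop
      (𝓝 (∫ x, f x ∂(targetMeasure μ π))) := by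
  have := H.markov
  have hW0 : ∀ x, 0 < driftW π τ x := fun x => zero_lt_one.trans_le (H.one_le_W x)
  have hbdd : ∀ a ∈ Set.Ioo (0 : ℝ) 1,
      ∀ᵐ ω ∂Pr, ∃ B, ∀ n, cesaroAvg (fun k => driftW π τ (X k ω) ^ a) n ≤ B := by
    intro a ha
    refine HD.ae_exists_cesaroAvg_le ha (contraction_factor_lt_one H.mem_υ ha.1 H.mem_lam) ?_
    have hV : Continuous fun x => driftW π τ x ^ a :=
      H.continuous_W.rpow_const fun x => Or.inr ha.1.le
    have hVm : MemL (driftW π τ) fun x => driftW π τ x ^ a :=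
      ⟨1, fun x => (div_le_iff₀ (hW0 x)).2 (by
        rw [abs_of_nonneg (Real.rpow_nonneg (hW0 x).le _), one_mul]
        simpa using Real.rpow_le_rpow_of_exponent_le (H.one_le_W x) ha.2.le)⟩
    filter_upwards [hY _ hV hVm] with ω hω
    obtain ⟨B, hB⟩ := hω.bddAbove_range
    refine ⟨b ^ a + B, fun k => ?_⟩
    refine (integral_rpow_samplerKernel_le H.cont H.pos H.mem_υ H.continuous_W.measurable
      H.one_le_W ⟨ha.1, ha.2.le⟩ H.mem_lam.1.le H.b_nonneg H.integrable_P H.drift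
      (integrable_empiricalMeasure Y k ω _) (X k ω)).trans ?_
    have h1 : ∫ y, driftW π τ y ^ a ∂(empiricalMeasure Y k ω) ≤ B := hB ⟨k, rfl⟩
    linarith
  set Q := samplerOp π T υ P (temperedMeasure μ π T) with hQ
  obtain ⟨α, B, hα0, hα1, hB0, hgeo⟩ := H.exists_geometric_bound ha hf hfC
  have hstep : ∀ᵐ ω ∂Pr, ∀ N : ℕ, Tendsto (cesaroAvg fun k =>
      (Q^[N] f) (X k ω) - Q (Q^[N] f) (X k ω)) atTop (𝓝 0) := by
    rw [ae_all_iff]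
    intro N
    obtain ⟨h1, C', h2⟩ := H.iterate_samplerOp_class ha hf hfC N
    exact H.ae_tendsto_cesaroAvg_sub_samplerOp HD hY hbdd ha h1 h2
  filter_upwards [hstep, hbdd a ha] with ω h1 ⟨D, hD⟩
  have hD0 : 0 ≤ D := (cesaroAvg_nonneg (fun k => Real.rpow_nonneg (hW0 (X k ω)).le a) 0).trans (hD 0)
  have h2 : ∀ N : ℕ, Tendsto (cesaroAvg fun k => f (X k ω) - (Q^[N] f) (X k ω)) atTop (𝓝 0) := by
    intro N
    induction N with
    | zero =>
      refine tendsto_const_nhds.congr fun n => ?_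
      simp [cesaroAvg]
    | succ N ih =>
      have h3 := ih.add (h1 N)
      rw [add_zero] at h3
      refine h3.congr fun n => ?_
      rw [← cesaroAvg_add]
      congr 1
      funext k
      rw [Function.iterate_succ_apply']
      ring
  set m := ∫ x, f x ∂(targetMeasure μ π) with hm
  rw [Metric.tendsto_atTop]
  intro ε hε
  have hlim : Tendsto (fun N : ℕ => B * α ^ N * D) atTop (𝓝 0) := by
    simpa using ((tendsto_pow_atTop_nhds_zero_of_lt_one hα0 hα1).const_mul B).mul_const D
  -- `N` is chosen after `ω`, through the random bound `D`; this is why `hstep` holds for all `N` on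
  -- one event.
  obtain ⟨N, hN⟩ := (hlim.eventually (gt_mem_nhds (half_pos hε))).exists
  obtain ⟨n₀, hn₀⟩ := Metric.tendsto_atTop.1 (h2 N) (ε / 2) (half_pos hε)
  refine ⟨n₀ + 1, fun n hn => ?_⟩
  have h3 := hn₀ n (by omega)
  rw [Real.dist_eq, sub_zero] at h3
  have h4 : |cesaroAvg (fun k => (Q^[N] f) (X k ω) - m) n| ≤ B * α ^ N * D := by
    refine (abs_cesaroAvg_le _ n).trans ((cesaroAvg_mono (fun k => hgeo N (X k ω)) n).trans ?_)
    rw [cesaroAvg_const_mul]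
    exact mul_le_mul_of_nonneg_left (hD n) (by positivity)
  have h5 : cesaroAvg (fun k => f (X k ω)) n - m =
      cesaroAvg (fun k => f (X k ω) - (Q^[N] f) (X k ω)) n
        + cesaroAvg (fun k => (Q^[N] f) (X k ω) - m) n := by
    rw [cesaroAvg_sub, cesaroAvg_sub, cesaroAvg_const m (by omega)]
    ring
  rw [Real.dist_eq, h5]
  refine (abs_add_le _ _).trans_lt ?_
  linarith

end SamplePaths

end IsTemperingModel

/-! ### From continuous functions to continuity sets. -/

section Portmanteau

variable {E Ω : Type*} [TopologicalSpace E] [TopologicalSpace.PseudoMetrizableSpace E]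
  [MeasurableSpace E]
  [BorelSpace E] [MeasurableSpace Ω] {Pr : Measure Ω} {ρ : Measure E} [IsProbabilityMeasure ρ]
  {X : ℕ → Ω → E}

/-- A closed set is approximated from outside by a sequence of continuous functions, so countably
many exceptional null sets suffice. Applied to the closures of `A` and `Aᶜ`, the one-sided bound
gives both halves of the limit for a continuity set. -/
lemma ae_eventually_cesaroAvg_indicator_le
    (h : ∀ f : E → ℝ, Continuous f → (∀ x, |f x| ≤ 1) →
      ∀ᵐ ω ∂Pr, Tendsto (cesaroAvg fun k => f (X k ω)) atTop (𝓝 (∫ x, f x ∂ρ)))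
    {F : Set E} (hF : IsClosed F) :
    ∀ᵐ ω ∂Pr, ∀ ε > 0, ∀ᶠ n in atTop,
      cesaroAvg (fun k => F.indicator (fun _ => (1 : ℝ)) (X k ω)) n ≤ ρ.real F + ε := by
  set g : ℕ → E → ℝ := fun j x => (hF.apprSeq j x : ℝ) with hg
  have hgc : ∀ j, Continuous (g j) := fun j =>
    NNReal.continuous_coe.comp (hF.apprSeq j).continuous
  have hg1 : ∀ j x, |g j x| ≤ 1 := fun j x => by
    rw [abs_of_nonneg (NNReal.coe_nonneg _)]
    exact_mod_cast HasOuterApproxClosed.apprSeq_apply_le_one hF j x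
  have hFg : ∀ j x, F.indicator (fun _ => (1 : ℝ)) x ≤ g j x := fun j x => by
    by_cases hx : x ∈ F
    · simp [hg, hx, HasOuterApproxClosed.apprSeq_apply_eq_one hF j hx]
    · simp [hg, hx]
  have hlim : Tendsto (fun j => ∫ x, g j x ∂ρ) atTop (𝓝 (ρ.real F)) := by
    have h1 := (ENNReal.tendsto_toReal (measure_ne_top ρ F)).comp
      (HasOuterApproxClosed.tendsto_lintegral_apprSeq hF ρ)
    exact h1.congr fun j =>
      BoundedContinuousFunction.toReal_lintegral_coe_eq_integral (hF.apprSeq j) ρ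
  filter_upwards [ae_all_iff.2 fun j => h (g j) (hgc j) (hg1 j)] with ω hω ε hε
  obtain ⟨j, hj⟩ := (hlim.eventually (gt_mem_nhds (lt_add_of_pos_right (ρ.real F) hε))).exists
  filter_upwards [(hω j).eventually (gt_mem_nhds hj)] with n hn
  exact (cesaroAvg_mono (fun k => hFg j (X k ω)) n).trans hn.le

/-- Almost sure convergence of averages of bounded continuous functions entails that of the
occupation frequencies of continuity sets. -/
lemma ae_tendsto_cesaroAvg_indicator
    (h : ∀ f : E → ℝ, Continuous f → (∀ x, |f x| ≤ 1) →
      ∀ᵐ ω ∂Pr, Tendsto (cesaroAvg fun k => f (X k ω)) atTop (𝓝 (∫ x, f x ∂ρ)))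
    {A : Set E} (hA : MeasurableSet A) (hfr : ρ (frontier A) = 0) :
    ∀ᵐ ω ∂Pr, Tendsto (cesaroAvg fun k => A.indicator (fun _ => (1 : ℝ)) (X k ω)) atTop
      (𝓝 (ρ.real A)) := by
  have hA' : ρ.real (closure A) = ρ.real A := by
    rw [measureReal_def, measure_closure_of_null_frontier hfr, measureReal_def]
  have hAc : ρ.real (closure Aᶜ) = 1 - ρ.real A := by
    rw [measureReal_def, measure_closure_of_null_frontier (by rwa [frontier_compl]),
      ← measureReal_def, probReal_compl_eq_one_sub hA]
  have hle : ∀ (S : Set E) x, S.indicator (fun _ => (1 : ℝ)) x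
      ≤ (closure S).indicator (fun _ => (1 : ℝ)) x := fun S x =>
    Set.indicator_le_indicator_of_subset subset_closure (fun _ => zero_le_one) x
  filter_upwards [ae_eventually_cesaroAvg_indicator_le h (isClosed_closure (s := A)),
    ae_eventually_cesaroAvg_indicator_le h (isClosed_closure (s := Aᶜ))] with ω h1 h2
  rw [Metric.tendsto_nhds]
  intro ε hε
  filter_upwards [h1 (ε / 2) (half_pos hε), h2 (ε / 2) (half_pos hε), eventually_ne_atTop 0]
    with n hn1 hn2 hn0
  rw [hA'] at hn1
  rw [hAc] at hn2
  have h3 := cesaroAvg_mono (fun k => hle A (X k ω)) n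
  have h4 := cesaroAvg_mono (fun k => hle Aᶜ (X k ω)) n
  have h5 : cesaroAvg (fun k => Aᶜ.indicator (fun _ => (1 : ℝ)) (X k ω)) n
      = 1 - cesaroAvg (fun k => A.indicator (fun _ => (1 : ℝ)) (X k ω)) n := by
    refine eq_sub_of_add_eq (Eq.trans ?_ (cesaroAvg_const 1 hn0))
    rw [← cesaroAvg_add]
    congr 1
    funext k
    by_cases hx : X k ω ∈ A <;> simp [hx]
  rw [Real.dist_eq]
  exact abs_lt.2 ⟨by linarith, by linarith⟩

end Portmanteau

/-! ### Assembly of the theorem. -/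

/-- A nonnegative function with finite integral in `ℝ≥0∞` after `ENNReal.ofReal` is integrable,
and bounds of the former integral pass to the Bochner integral. -/
lemma integrable_and_integral_le_of_lintegral {α : Type*} [MeasurableSpace α] {m : Measure α}
    {f : α → ℝ} (hf : Measurable f) (hf0 : ∀ x, 0 ≤ f x) {r : ℝ≥0∞} (hr : r ≠ ∞)
    (h : ∫⁻ x, ENNReal.ofReal (f x) ∂m ≤ r) : Integrable f m ∧ ∫ x, f x ∂m ≤ r.toReal := by
  refine ⟨(lintegral_ofReal_ne_top_iff_integrable hf.aestronglyMeasurable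
    (ae_of_all _ hf0)).1 (ne_top_of_le_ne_top hr h), ?_⟩
  rw [integral_eq_lintegral_of_nonneg_ae (ae_of_all _ hf0) hf.aestronglyMeasurable]
  exact ENNReal.toReal_mono hr h

end InteractingTempering

theorem theorem3p5
    {E : Type*} [TopologicalSpace E] [PolishSpace E] [MeasurableSpace E] [BorelSpace E]
    (μ : Measure E) (π : E → ℝ) (T υ : ℝ) (hT : 1 < T) (hυ : υ ∈ Set.Ioo (0 : ℝ) 1)
    -- `π` is a continuous, positive, bounded probability density, and `π^{1/T}` is normalisable
    (hπ_cont : Continuous π) (hπ_pos : ∀ x, 0 < π x) (hπ_bdd : BddAbove (Set.range π))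
    (hπ_prob : ∫⁻ x, ENNReal.ofReal (π x) ∂μ = 1)
    (hπ_temp : Integrable (fun x => π x ^ (1 / T)) μ)
    -- the kernel `P`
    (P : Kernel E E) [IsMarkovKernel P]
    (hP_irr : Kernel.IsIrreducible (targetMeasure μ π) P)
    (hP_aper : IsAperiodic (targetMeasure μ π) P)
    (hP_feller : IsFeller P)
    (hP_inv : Kernel.Invariant P (targetMeasure μ π))
    (τ lam b : ℝ) (hτ : τ ∈ Set.Ioo 0 (1 / T)) (hlam : lam ∈ Set.Ioo (0 : ℝ) 1)
    (hP_drift : ∀ x, ∫⁻ y, ENNReal.ofReal (driftW π τ y) ∂(P x)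
      ≤ ENNReal.ofReal (lam * driftW π τ x + b))
    (hP_small : ∀ p ∈ Set.Ioo 0 (supNorm π), IsOneSmall P {x | p ≤ π x})
    -- the processes
    {Ω : Type*} [MeasurableSpace Ω] (Pr : Measure Ω) [IsProbabilityMeasure Pr]
    (ℱ : Filtration ℕ (inferInstance : MeasurableSpace Ω))
    (X Y : ℕ → Ω → E) (hXY : IsSampler Pr ℱ π T υ P X Y)
    (hY_int : ∫⁻ x, ENNReal.ofReal (driftW π τ x) ∂(temperedMeasure μ π T) < ∞)
    (hY_lln : ∀ f : E → ℝ, Continuous f → MemL (driftW π τ) f →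
      ∀ᵐ ω ∂Pr, Tendsto (fun n => ∫ x, f x ∂(empiricalMeasure Y n ω)) atTop
        (𝓝 (∫ x, f x ∂(temperedMeasure μ π T))))
    (hY_mom : (⨆ n, ∫⁻ ω, ENNReal.ofReal (driftW π τ (Y n ω)) ∂Pr) < ∞)
    (hX_mom : ∫⁻ ω, ENNReal.ofReal (driftW π τ (X 0 ω)) ∂Pr < ∞) :
    (∀ A : Set E, MeasurableSet A → ∫ x in frontier A, π x ∂μ = 0 →
      ∀ᵐ ω ∂Pr, Tendsto
        (fun n : ℕ => (1 / (n : ℝ)) * ∑ k ∈ Finset.range n, A.indicator (fun _ => (1 : ℝ)) (X k ω))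
        atTop (𝓝 (∫ x in A, π x ∂μ))) ∧
    (∀ a ∈ Set.Ioo (0 : ℝ) 1, ∀ f : E → ℝ, Continuous f →
      MemL (fun x => driftW π τ x ^ a) f →
        Integrable (fun x => f x * π x) μ ∧
        ∀ᵐ ω ∂Pr, Tendsto
          (fun n : ℕ => (1 / (n : ℝ)) * ∑ k ∈ Finset.range n, f (X k ω))
          atTop (𝓝 (∫ x, f x * π x ∂μ))) := by
  have hτ0 : 0 < τ := hτ.1
  have hW1 : ∀ x, 1 ≤ driftW π τ x := one_le_driftW hπ_pos hπ_bdd hτ0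
  have hW0 : ∀ x, 0 ≤ driftW π τ x := fun x => zero_le_one.trans (hW1 x)
  have hWc : Continuous (driftW π τ) := continuous_driftW hπ_cont hπ_pos hπ_bdd τ
  have hWX : ∀ Z : ℕ → Ω → E, (∀ n, Measurable[ℱ n] (Z n)) → ∀ n,
      Measurable fun ω => driftW π τ (Z n ω) := fun Z hZ n =>
    hWc.measurable.comp ((hZ n).mono (ℱ.le n) le_rfl)
  have hP := fun x => integrable_and_integral_le_of_lintegral hWc.measurable hW0
    ENNReal.ofReal_ne_top (hP_drift x)
  -- `b` may be negative, while the bound on `W ^ a` involves `b ^ a`; enlarging `b` to `max b 0`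
  -- preserves the drift inequality.
  have H : IsTemperingModel μ π T υ P τ lam (max b 0) :=
    { one_lt_T := hT
      mem_υ := hυ
      cont := hπ_cont
      pos := hπ_pos
      bdd := hπ_bdd
      prob := hπ_prob
      temp := hπ_temp
      markov := inferInstance
      feller := hP_feller
      inv := hP_inv
      τ_pos := hτ0
      mem_lam := hlam
      b_nonneg := le_max_right _ _
      integrable_P := fun x => (hP x).1
      drift := fun x => by
        refine (hP x).2.trans ?_
        have h1 : 0 ≤ lam * driftW π τ x := mul_nonneg hlam.1.le (hW0 x)
        rw [ENNReal.toReal_ofReal']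
        exact max_le (add_le_add le_rfl (le_max_left _ _)) (add_nonneg h1 (le_max_right _ _))
      small := hP_small
      integrable_tempered :=
        (integrable_and_integral_le_of_lintegral hWc.measurable hW0 hY_int.ne le_rfl).1 }
  have hY := fun n => integrable_and_integral_le_of_lintegral (hWX Y hXY.adapted_Y n)
    (fun ω => hW0 _) hY_mom.ne
    (le_iSup (fun n => ∫⁻ ω, ENNReal.ofReal (driftW π τ (Y n ω)) ∂Pr) n)
  have HD := H.isDriftedChain hXY (fun n => (hY n).1) (fun n => (hY n).2)
    (integrable_and_integral_le_of_lintegral (hWX X hXY.adapted_X 0) (fun ω => hW0 _)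
      hX_mom.ne le_rfl).1
  have := isProbabilityMeasure_targetMeasure hπ_prob
  have hreal : ∀ A : Set E, MeasurableSet A →
      (targetMeasure μ π).real A = ∫ x in A, π x ∂μ := fun A hA => by
    rw [← integral_indicator_one hA, integral_targetMeasure hπ_cont hπ_pos,
      ← integral_indicator hA]
    refine integral_congr_ae (ae_of_all _ fun x => ?_)
    by_cases hx : x ∈ A <;> simp [hx]
  refine ⟨fun A hA hfr => ?_, fun a ha f hf ⟨C, hC⟩ => ?_⟩
  · rw [← hreal _ isClosed_frontier.measurableSet, measureReal_eq_zero_iff] at hfr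
    rw [← hreal A hA]
    refine ae_tendsto_cesaroAvg_indicator (fun g hg hg1 => ?_) hA hfr
    -- Any exponent in `(0, 1)` would do, since `|g| ≤ 1 ≤ W ^ a`.
    exact H.ae_tendsto_cesaroAvg HD hY_lln (a := 1 / 2) (by norm_num) hg (C := 1) fun x =>
      (hg1 x).trans (by rw [one_mul]; exact Real.one_le_rpow (hW1 x) (by norm_num))
  · have hfC : ∀ x, |f x| ≤ C * driftW π τ x ^ a := fun x =>
      (div_le_iff₀ (Real.rpow_pos_of_pos (zero_lt_one.trans_le (hW1 x)) a)).1 (hC x)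
    refine ⟨(integrable_targetMeasure_iff hπ_cont hπ_pos).1
      (H.integrable_target_of_class ha hf hfC).2, ?_⟩
    rw [← integral_targetMeasure hπ_cont hπ_pos]
    exact H.ae_tendsto_cesaroAvg HD hY_lln ha hf hfC
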